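/- Let $\Gamma$ be a metrized graph: a finite connected graph (multiple edges and self-loops allowed) with finite non-empty vertex set $V(\Gamma)$ and finite edge set $E(\Gamma)$, each edge $e_i$ being parametrized by arclength by a segment $[0,L_i]$, $L_i>0$. For $y,z\in\Gamma$ let $x\mapsto j_z(x,y)$ be the voltage function, i.e. the continuous function on $\Gamma$, with $C^2$ restriction away from a finite set, such that $j_z(z,y)=0$ and $\Delta_x j_z(x,y)=\delta_y-\delta_z$, where $\Delta f=-f''(x)\,dx-\sum_{p}\big[\sum_{\vec v\text{ at }p}d_{\vec v}f(p)\big]\delta_p$; let $r(x,y)=j_x(y,y)$ be the resistance function. For a finite signed Borel measure $\mu$ on $\Gamma$ put $j_\mu(x,y)=\int_\Gamma j_\zeta(x,y)\,d\mu(\zeta)$. A canonical measure on $\Gamma$ is a finite signed Borel measure $\mu$ with $\mu(\Gamma)=1$ such that $j_\mu(x,x)$ is constant on $\Gamma$. Then a canonical measure $\mu_{\mathrm{can}}$ exists, and the constant $\tau(\Gamma):=\frac12 j_{\mu}(x,x)$ is the same for every canonical measure $\mu$ and every $x\in\Gamma$. Moreover, for every vertex $p\in V(\Gamma)$, $$\tau(\Gamma)=-\frac14\sum_{q\in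 V(\Gamma)}(\upsilon(q)-2)\,r(p,q)+\frac12\sum_{e_i\in E(\Gamma)}\frac{1}{L_i+R_i}\int_0^{L_i}r(p,x)\,dx .$$ Here $\upsilon(q)$ is the valence of $q$, i.e. the number of directions emanating from $q$ (a self-loop at $q$ counts twice); $R_i$ is the effective resistance between the end points of $e_i$ in the graph $\Gamma-e_i$ obtained by deleting the interior of $e_i$, with $R_i=\infty$ and $\frac1{L_i+R_i}=0$ if $\Gamma-e_i$ is not connected; and in the integral $x\in[0,L_i]$ stands for the corresponding point of $e_i$. -/

import Mathlib

open MeasureTheory Set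
open scoped Topology ENNReal

/-- A finite multigraph (multiple edges and self-loops allowed) with vertex set `V` and edge set
`E`, each edge `e` being parametrized by the segment `[0, len e]`, which starts at `src e` and ends
at `tgt e`. Connectedness is the separate predicate `MetricGraph.Connected`; a metrized graph is a
connected `MetricGraph` with finite `V ≠ ∅` and finite `E`. -/
structure MetricGraph (V E : Type*) where
  src : E → V
  tgt : E → V
  len : E → ℝ
  len_pos : ∀ e, 0 < len e

namespace MetricGraph

variable {V E : Type*} (Γ : MetricGraph V E)

/-- Any two vertices are joined by a chain of edges. -/
def Connected : Prop :=
  ∀ u v : V, Relation.EqvGen (fun a b => ∃ e, Γ.src e = a ∧ Γ.tgt e = b) u v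

/-- `Γ - e`: the interior points of the edge `e` are deleted, all vertices are kept. -/
def deleteEdge (e : E) : MetricGraph V {e' : E // e' ≠ e} where
  src e' := Γ.src e'
  tgt e' := Γ.tgt e'
  len e' := Γ.len e'
  len_pos e' := Γ.len_pos e'

/-- The valence of a vertex: the number of directions emanating from it. A self-loop
contributes two directions. -/
noncomputable def valence (v : V) : ℕ :=
  Nat.card {e : E // Γ.src e = v} + Nat.card {e : E // Γ.tgt e = v}

/-! ### The topological space of points of the graph -/

/-- The disjoint union of the vertices and of the segments `[0, len e]`. -/
def PreSpace : Type _ := V ⊕ (Σ e : E, Icc (0 : ℝ) (Γ.len e))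

/-- The vertices are discrete, the segments carry the topology of the real line. -/
instance : TopologicalSpace Γ.PreSpace :=
  letI : TopologicalSpace V := ⊥
  inferInstanceAs (TopologicalSpace (V ⊕ (Σ e : E, Icc (0 : ℝ) (Γ.len e))))

/-- The gluing: `0 ∈ [0, len e]` is glued to `src e`, and `len e` to `tgt e`. -/
inductive Glue : Γ.PreSpace → Γ.PreSpace → Prop
  | src (e : E) : Glue (Sum.inr ⟨e, ⟨0, le_rfl, (Γ.len_pos e).le⟩⟩) (Sum.inl (Γ.src e))
  | tgt (e : E) : Glue (Sum.inr ⟨e, ⟨Γ.len e, (Γ.len_pos e).le, le_rfl⟩⟩) (Sum.inl (Γ.tgt e))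

/-- The space of all points of `Γ`, with the quotient topology. -/
def Space : Type _ := Quot Γ.Glue

instance : TopologicalSpace Γ.Space := inferInstanceAs (TopologicalSpace (Quot Γ.Glue))

instance : MeasurableSpace Γ.Space := borel Γ.Space

instance : BorelSpace Γ.Space := ⟨rfl⟩

/-- A vertex as a point of `Γ`. -/
def vertex (v : V) : Γ.Space := Quot.mk _ (Sum.inl v)

/-- The arclength parametrization of the edge `e`: for `0 ≤ t ≤ len e`, the point at
distance `t` from the start of `e` (outside `[0, len e]` the parameter is clamped). -/
noncomputable def edgePoint (e : E) (t : ℝ) : Γ.Space :=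
  Quot.mk _ (Sum.inr ⟨e, projIcc 0 (Γ.len e) (Γ.len_pos e).le t⟩)

/-! ### Voltage and resistance -/

/-- The derivative of `f` at the point `t` of the edge `e`, in the outgoing direction in which
the parameter of `e` increases. -/
noncomputable def slopeUp (f : Γ.Space → ℝ) (e : E) (t : ℝ) : ℝ :=
  derivWithin (fun s => f (Γ.edgePoint e s)) (Ici t) t

/-- The derivative of `f` at the point `t` of the edge `e`, in the outgoing direction in which
the parameter of `e` decreases. -/
noncomputable def slopeDown (f : Γ.Space → ℝ) (e : E) (t : ℝ) : ℝ :=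
  -derivWithin (fun s => f (Γ.edgePoint e s)) (Iic t) t

open Classical in
/-- The mass at the point `p` of the measure `δ_y - δ_z`: the unit current entering at `y` and
exiting at `z`. -/
noncomputable def source (z y p : Γ.Space) : ℝ :=
  (if p = y then 1 else 0) - (if p = z then 1 else 0)

open Classical in
/-- `f` is the voltage `x ↦ j_z(x, y)`: unit current enters at `y` and exits at `z`, and `z` has
voltage `0`. In terms of the Laplacian, `f` is continuous, `f z = 0` and `Δ f = δ_y - δ_z`: the
second derivative of `f` vanishes in the interior of the edges away from `y` and `z` (that is, `f`
is locally affine there), and at every point `p` of `Γ` minus the sum of the derivatives of `f` in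
the directions emanating from `p` is the mass of `δ_y - δ_z` at `p`. -/
structure IsVoltage [Fintype E] (z y : Γ.Space) (f : Γ.Space → ℝ) : Prop where
  continuous : Continuous f
  ground : f z = 0
  affine : ∀ e, ∀ t ∈ Ioo 0 (Γ.len e), Γ.edgePoint e t ≠ y → Γ.edgePoint e t ≠ z →
    ∃ a : ℝ, ∀ᶠ s in 𝓝 t, f (Γ.edgePoint e s) = f (Γ.edgePoint e t) + a * (s - t)
  interior : ∀ e, ∀ t ∈ Ioo 0 (Γ.len e),
    -(Γ.slopeUp f e t + Γ.slopeDown f e t) = Γ.source z y (Γ.edgePoint e t)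
  vertices : ∀ v : V,
    -((∑ e : E, if Γ.src e = v then Γ.slopeUp f e 0 else 0) +
      (∑ e : E, if Γ.tgt e = v then Γ.slopeDown f e (Γ.len e) else 0)) =
      Γ.source z y (Γ.vertex v)

/-- The voltage function `voltage z x y = j_z(x, y)`. -/
noncomputable def voltage [Fintype E] (z x y : Γ.Space) : ℝ :=
  Classical.epsilon (fun f : Γ.Space → ℝ => Γ.IsVoltage z y f) x

/-- The resistance function `r(x, y) = j_x(y, y)`. -/
noncomputable def resistance [Fintype E] (x y : Γ.Space) : ℝ := Γ.voltage x y y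

open Classical in
/-- `R_e`: the effective resistance between the end points of the edge `e` in the graph `Γ - e`,
which is `∞` if `Γ - e` is not connected. -/
noncomputable def edgeResistance [Fintype E] (e : E) : ℝ≥0∞ :=
  if (Γ.deleteEdge e).Connected then
    ENNReal.ofReal ((Γ.deleteEdge e).resistance
      ((Γ.deleteEdge e).vertex (Γ.src e)) ((Γ.deleteEdge e).vertex (Γ.tgt e)))
  else ⊤

/-! ### The canonical measure and the tau constant -/

/-- `j_μ(x, y) = ∫ j_ζ(x, y) dμ(ζ)` for a signed Borel measure `μ` on `Γ`. -/
noncomputable def voltageMeasure [Fintype E] (μ : SignedMeasure Γ.Space) (x y : Γ.Space) : ℝ :=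
  ∫ᵛ ζ, Γ.voltage ζ x y ∂<•μ

/-- The signed measure `μ` has total mass `1` and `j_μ(x, x)` is constant on `Γ`. -/
def IsCanonicalMeasure [Fintype E] (μ : SignedMeasure Γ.Space) : Prop :=
  μ univ = 1 ∧ ∃ c : ℝ, ∀ x, Γ.voltageMeasure μ x x = c

/-- The canonical measure `μ_can`. -/
noncomputable def canonicalMeasure [Fintype E] : SignedMeasure Γ.Space :=
  Classical.epsilon Γ.IsCanonicalMeasure

/-- The tau constant `τ(Γ)`: the constant value of `½ j_μ(x, x)` for `μ = μ_can`. -/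
noncomputable def tau [Fintype E] [Nonempty V] : ℝ :=
  (1 / 2) * Γ.voltageMeasure Γ.canonicalMeasure
    (Γ.vertex (Classical.arbitrary V)) (Γ.vertex (Classical.arbitrary V))

end MetricGraph

/-! Everything is read off from one symmetric Green's function `g` with `Δ_x g(x, y) = δ_y - δ_o`.
It gives `j_z(x, y) = g(x, y) - g(x, z) - g(z, y) + g(z, z)`, hence `r(x, y) = g(x, x) + g(y, y) - 2
g(x, y)`. Since `j_ζ(x, x) = r(ζ, x)`, a signed measure `μ` of mass 1 is canonical exactly when `∫
r(ζ, x) dμ(ζ)` does not depend on `x`. To build `g`, a Green's function of the weighted graph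
Laplacian on the vertices (`Connected.exists_isGreen`) is interpolated along the edges, and the
Dirichlet Green's function of each edge is added (`IsGreen.hasLaplacian`).

The claimed formula is half the integral of `r(p, ·)` against `ν = ∑ (1 - υ(q)/2) δ_q + ∑ dx/(L_i +
R_i)`. So two things are needed.

The measure `ν` is canonical. If `ρ` is the resistance in `Γ` between the ends of an edge, its
density is `(L - ρ)/L²` (`IsGreen.inv_len_add_edgeResistance`). On each edge `g(x, x)` and `2 ∫ g(x,
y) dν(y)` have the same quadratic part (`IsGreen.green_self`, `IsGreen.canonicalIntegral_green`), so
their difference interpolates its vertex values. These are harmonic, hence constant, by Foster's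
theorem (`IsGreen.foster`, `IsGreen.canonical_const`), which also gives `ν` mass 1.

All canonical measures have the same constant. Integrating the symmetric function `r` against `μ ×
ν` in both orders (`canonicalIntegral_integral_swap`) yields the constant of `μ` one way and that of
`ν` the other. -/

namespace MetricGraph

/-! ### The weighted graph Laplacian on the vertices, its Green's function, and Foster's theorem -/

section Discrete

open Classical in
/-- The indicator function of the point `a`. -/
noncomputable def pointMass {X : Type*} (a x : X) : ℝ := if x = a then 1 else 0

@[simp] lemma pointMass_self {X : Type*} (a : X) : pointMass a a = 1 := by simp [pointMass]

lemma pointMass_of_ne {X : Type*} {a x : X} (h : x ≠ a) : pointMass a x = 0 := by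
  simp [pointMass, h]

lemma pointMass_comm {X : Type*} (a x : X) : pointMass a x = pointMass x a := by
  by_cases h : x = a
  · rw [h]
  · rw [pointMass_of_ne h, pointMass_of_ne (Ne.symm h)]

open Classical in
lemma mul_pointMass {X : Type*} (r : ℝ) (a x : X) :
    r * pointMass a x = if a = x then r else 0 := by
  rw [pointMass_comm]
  simp [pointMass]

@[simp] lemma sum_mul_pointMass {X : Type*} [Fintype X] (f : X → ℝ) (a : X) :
    ∑ x, f x * pointMass a x = f a := by
  classical simp [pointMass]

@[simp] lemma sum_pointMass {X : Type*} [Fintype X] (a : X) : ∑ x, pointMass a x = 1 := by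
  classical simp [pointMass]

lemma pointMass_comp {X Y : Type*} {g : X → Y} (hg : Function.Injective g) (a x : X) :
    pointMass (g a) (g x) = pointMass a x := by
  by_cases h : x = a
  · simp [h]
  · rw [pointMass_of_ne h, pointMass_of_ne (hg.ne h)]

variable {V E : Type*} (Γ : MetricGraph V E) [Fintype E]

/-- The weighted graph Laplacian on functions on the vertices. -/
noncomputable def lap : (V → ℝ) →ₗ[ℝ] (V → ℝ) where
  toFun H v := ∑ e, (H (Γ.tgt e) - H (Γ.src e)) / Γ.len e *
    (pointMass (Γ.tgt e) v - pointMass (Γ.src e) v)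
  map_add' H H' := by
    ext v
    simp only [Pi.add_apply, ← Finset.sum_add_distrib]
    exact Finset.sum_congr rfl fun e _ => by ring
  map_smul' c H := by
    ext v
    simp only [Pi.smul_apply, smul_eq_mul, RingHom.id_apply, Finset.mul_sum]
    exact Finset.sum_congr rfl fun e _ => by ring

lemma lap_apply (H : V → ℝ) (v : V) : Γ.lap H v =
    ∑ e, (H (Γ.tgt e) - H (Γ.src e)) / Γ.len e *
      (pointMass (Γ.tgt e) v - pointMass (Γ.src e) v) := rfl

variable [Fintype V]

/-- Summation by parts: the Laplacian comes from the Dirichlet form, whence its symmetry, positivity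
and zero total mass. -/
lemma sum_mul_lap (F H : V → ℝ) : ∑ v, F v * Γ.lap H v =
    ∑ e, (H (Γ.tgt e) - H (Γ.src e)) / Γ.len e * (F (Γ.tgt e) - F (Γ.src e)) := by
  simp only [lap_apply, Finset.mul_sum]
  rw [Finset.sum_comm]
  refine Finset.sum_congr rfl fun e _ => ?_
  rw [← sum_mul_pointMass F (Γ.tgt e), ← sum_mul_pointMass F (Γ.src e),
    ← Finset.sum_sub_distrib, Finset.mul_sum]
  exact Finset.sum_congr rfl fun v _ => by ring

lemma sum_mul_lap_comm (F H : V → ℝ) : ∑ v, F v * Γ.lap H v = ∑ v, H v * Γ.lap F v := by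
  rw [sum_mul_lap, sum_mul_lap]
  exact Finset.sum_congr rfl fun e _ => by ring

lemma sum_lap (H : V → ℝ) : ∑ v, Γ.lap H v = 0 := by
  simpa using Γ.sum_mul_lap (fun _ => 1) H

lemma sum_mul_lap_self_nonneg (H : V → ℝ) : 0 ≤ ∑ v, H v * Γ.lap H v := by
  rw [sum_mul_lap]
  refine Finset.sum_nonneg fun e _ => ?_
  rw [div_mul_eq_mul_div]
  exact div_nonneg (mul_self_nonneg _) (Γ.len_pos e).le

variable {Γ}

omit [Fintype E] [Fintype V] in
lemma Connected.eq_of_edges (hΓ : Γ.Connected) {X : Type*} {H : V → X}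
    (h : ∀ e, H (Γ.tgt e) = H (Γ.src e)) (u v : V) : H u = H v := by
  induction hΓ u v with
  | rel x y hxy => obtain ⟨e, rfl, rfl⟩ := hxy; exact (h e).symm
  | refl x => rfl
  | symm x y _ ih => exact ih.symm
  | trans x y z _ _ ih1 ih2 => exact ih1.trans ih2

/-- The energy is a sum of squares of edge differences with positive weights, so each difference
vanishes. -/
lemma Connected.eq_of_energy_eq_zero (hΓ : Γ.Connected) {H : V → ℝ}
    (h : ∑ v, H v * Γ.lap H v = 0) (u v : V) : H u = H v := by
  refine hΓ.eq_of_edges (fun e => ?_) u v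
  rw [sum_mul_lap] at h
  have hnn : ∀ e ∈ Finset.univ, 0 ≤ (H (Γ.tgt e) - H (Γ.src e)) / Γ.len e *
      (H (Γ.tgt e) - H (Γ.src e)) := fun e _ => by
    rw [div_mul_eq_mul_div]
    exact div_nonneg (mul_self_nonneg _) (Γ.len_pos e).le
  have h0 := (Finset.sum_eq_zero_iff_of_nonneg hnn).1 h e (Finset.mem_univ e)
  rw [div_mul_eq_mul_div, div_eq_zero_iff, or_iff_left (Γ.len_pos e).ne', mul_self_eq_zero] at h0
  exact sub_eq_zero.1 h0

lemma Connected.eq_of_lap_eq_zero (hΓ : Γ.Connected) {H : V → ℝ} (h : Γ.lap H = 0) (u v : V) :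
    H u = H v :=
  hΓ.eq_of_energy_eq_zero (by simp [h]) u v

variable (Γ) in
/-- `G` is a Green's function of the graph Laplacian, with pole at `o`. -/
structure IsGreen (o : V) (G : V → V → ℝ) : Prop where
  symm : ∀ u v, G u v = G v u
  lap_eq : ∀ y v, Γ.lap (G y) v = pointMass y v - pointMass o v

/-- The Laplacian kills constants. Adding the rank one form `F o * H o` makes it positive definite,
hence invertible, and keeps it symmetric; the columns of the inverse are the functions sought. -/
lemma Connected.exists_isGreen (hΓ : Γ.Connected) (o : V) : ∃ G, Γ.IsGreen o G := by
  let T : (V → ℝ) →ₗ[ℝ] (V → ℝ) :=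
    { toFun := fun H v => Γ.lap H v + H o * pointMass o v
      map_add' := fun H H' => by ext v; simp only [map_add, Pi.add_apply]; ring
      map_smul' := fun c H => by
        ext v; simp only [map_smul, Pi.smul_apply, smul_eq_mul, RingHom.id_apply]; ring }
  have hT : ∀ H v, T H v = Γ.lap H v + H o * pointMass o v := fun _ _ => rfl
  have hpair : ∀ F H : V → ℝ, ∑ v, F v * T H v = ∑ v, F v * Γ.lap H v + F o * H o := by
    intro F H
    simp only [hT, mul_add, Finset.sum_add_distrib]
    congr 1
    rw [← sum_mul_pointMass F o, Finset.sum_mul]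
    exact Finset.sum_congr rfl fun v _ => by ring
  have hinj : Function.Injective T := by
    rw [← LinearMap.ker_eq_bot, LinearMap.ker_eq_bot']
    intro H hH
    have h0 := hpair H H
    simp only [hH, Pi.zero_apply, mul_zero, Finset.sum_const_zero] at h0
    have h1 := Γ.sum_mul_lap_self_nonneg H
    have h2 : H o = 0 := by nlinarith [mul_self_nonneg (H o)]
    ext v
    rw [hΓ.eq_of_energy_eq_zero (H := H) (by nlinarith [mul_self_nonneg (H o)]) v o, h2]; rfl
  choose G hG using fun y => LinearMap.injective_iff_surjective.1 hinj (pointMass y)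
  -- Pair with the constant 1, on which the Laplacian part vanishes. The rank one term then
  -- contributes exactly the pole `pointMass o`.
  have hGo : ∀ y, G y o = 1 := fun y => by
    have := hpair (fun _ => 1) (G y)
    simpa [hG, sum_lap] using this.symm
  refine ⟨G, fun u v => ?_, fun y v => ?_⟩
  · have h1 := hpair (G u) (G v)
    have h2 := hpair (G v) (G u)
    simp only [hG, sum_mul_pointMass] at h1 h2
    rw [h1, h2, sum_mul_lap_comm, mul_comm (G u o)]
  · have := congrFun (hG y) v
    rw [hT, hGo, one_mul] at this
    linarith

variable (Γ) in
/-- The effective resistance between the end points of `e`, in terms of a Green's function. -/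
noncomputable def greenRes (G : V → V → ℝ) (e : E) : ℝ :=
  G (Γ.src e) (Γ.src e) + G (Γ.tgt e) (Γ.tgt e) - 2 * G (Γ.src e) (Γ.tgt e)

/-- Foster's theorem. -/
lemma IsGreen.foster {o : V} {G : V → V → ℝ} (hG : Γ.IsGreen o G) :
    ∑ e, Γ.greenRes G e / Γ.len e = Fintype.card V - 1 := by
  -- This is the trace of the Laplacian composed with `G`; expanding it edge by edge gives the
  -- resistances.
  have h1 : ∑ v, Γ.lap (G v) v = (Fintype.card V : ℝ) - 1 := by
    simp [hG.lap_eq]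
  rw [← h1]
  simp only [lap_apply]
  rw [Finset.sum_comm]
  refine Finset.sum_congr rfl fun e _ => ?_
  have h2 : ∀ v, (G v (Γ.tgt e) - G v (Γ.src e)) / Γ.len e *
      (pointMass (Γ.tgt e) v - pointMass (Γ.src e) v) =
      (G v (Γ.tgt e) - G v (Γ.src e)) / Γ.len e * pointMass (Γ.tgt e) v -
      (G v (Γ.tgt e) - G v (Γ.src e)) / Γ.len e * pointMass (Γ.src e) v := fun v => by ring
  simp only [h2, Finset.sum_sub_distrib, sum_mul_pointMass, greenRes,
    hG.symm (Γ.tgt e) (Γ.src e)]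
  ring

/-- The potential at the vertices of the canonical measure, together with the diagonal of the
Green's function. -/
lemma IsGreen.canonical_const {o : V} {G : V → V → ℝ} (hΓ : Γ.Connected) (hG : Γ.IsGreen o G) :
    ∃ c, ∀ v, G v v - 2 * ∑ q, G q v +
      ∑ e, Γ.greenRes G e / Γ.len e * (G (Γ.src e) v + G (Γ.tgt e) v) = c := by
  let D : V → ℝ := (fun v => G v v) - (2 : ℝ) • ∑ q, G q +
    ∑ e, (Γ.greenRes G e / Γ.len e) • (G (Γ.src e) + G (Γ.tgt e))
  have hD : ∀ v, G v v - 2 * ∑ q, G q v +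
      ∑ e, Γ.greenRes G e / Γ.len e * (G (Γ.src e) v + G (Γ.tgt e) v) = D v := fun v => by
    simp [D, mul_add]
  have hlap : Γ.lap D = 0 := by
    ext v
    -- For an edge from `v` to `w` of resistance `ρ`, `G v v - G w w = 2 * (G v v - G v w) - ρ`.
    -- Dividing by the length and summing compares the Laplacian of the diagonal with twice that of
    -- `G v` at `v`. Loops contribute nothing on either side.
    have hd : Γ.lap (fun v => G v v) v + ∑ e, Γ.greenRes G e / Γ.len e *
        (pointMass (Γ.src e) v + pointMass (Γ.tgt e) v) = 2 * (1 - pointMass o v) := by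
      have h1 := hG.lap_eq v v
      rw [pointMass_self] at h1
      rw [← h1, lap_apply, lap_apply, Finset.mul_sum, ← Finset.sum_add_distrib]
      refine Finset.sum_congr rfl fun e _ => ?_
      by_cases hs : v = Γ.src e <;> by_cases ht : v = Γ.tgt e
      · simp only [greenRes, ← hs, ← ht]; ring
      · simp only [pointMass_of_ne ht, ← hs, greenRes, pointMass_self]; ring
      · simp only [pointMass_of_ne hs, ← ht, greenRes, pointMass_self, hG.symm (Γ.src e) v]
        ring
      · simp [pointMass_of_ne hs, pointMass_of_ne ht]
    have hf := hG.foster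
    have hq : ∑ q, (pointMass q v - pointMass o v) = 1 - Fintype.card V * pointMass o v := by
      simp [pointMass_comm _ v]
    simp only [D, map_add, map_sub, map_smul, map_sum, Pi.add_apply, Pi.sub_apply, Pi.smul_apply,
      Finset.sum_apply, smul_eq_mul, hq, hG.lap_eq, Pi.zero_apply]
    have he : ∑ e, Γ.greenRes G e / Γ.len e * (pointMass (Γ.src e) v - pointMass o v +
        (pointMass (Γ.tgt e) v - pointMass o v)) = ∑ e, Γ.greenRes G e / Γ.len e *
        (pointMass (Γ.src e) v + pointMass (Γ.tgt e) v) -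
        2 * pointMass o v * ∑ e, Γ.greenRes G e / Γ.len e := by
      rw [Finset.mul_sum, ← Finset.sum_sub_distrib]
      exact Finset.sum_congr rfl fun e _ => by ring
    rw [he, hf]
    linarith
  exact ⟨D o, fun v => (hD v).trans (hΓ.eq_of_lap_eq_zero hlap v o)⟩

/-- The voltage drop caused by a unit current, in terms of a Green's function. -/
lemma IsGreen.drop_eq (hΓ : Γ.Connected) {o : V} {G : V → V → ℝ} (hG : Γ.IsGreen o G)
    {H : V → ℝ} {a b : V} (hH : ∀ v, Γ.lap H v = pointMass b v - pointMass a v) :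
    H b - H a = G a a + G b b - 2 * G a b := by
  have h : Γ.lap (H - (G b - G a)) = 0 := by
    ext v; simp [hH, hG.lap_eq]
  have := hΓ.eq_of_lap_eq_zero h a b
  simp only [Pi.sub_apply, hG.symm b a] at this
  linarith

end Discrete


/-! ### Points of the quotient space and functions on it -/

section Points

variable {V E : Type*} (Γ : MetricGraph V E)

/-- A function on the points of `Γ`, given by its values at the vertices and along the edges. -/
def lift {X : Type*} (φ : V → X) (ψ : E → ℝ → X) (h₀ : ∀ e, ψ e 0 = φ (Γ.src e))
    (h₁ : ∀ e, ψ e (Γ.len e) = φ (Γ.tgt e)) : Γ.Space → X :=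
  Quot.lift (Sum.elim φ fun p => ψ p.1 p.2) fun _ _ h => by
    cases h with
    | src e => exact h₀ e
    | tgt e => exact h₁ e

variable {Γ}

section lift

variable {X : Type*} {φ : V → X} {ψ : E → ℝ → X} {h₀ : ∀ e, ψ e 0 = φ (Γ.src e)}
  {h₁ : ∀ e, ψ e (Γ.len e) = φ (Γ.tgt e)}

@[simp] lemma lift_vertex (v : V) : Γ.lift φ ψ h₀ h₁ (Γ.vertex v) = φ v := rfl

lemma lift_edgePoint {e : E} {t : ℝ} (ht : t ∈ Icc 0 (Γ.len e)) :
    Γ.lift φ ψ h₀ h₁ (Γ.edgePoint e t) = ψ e t := by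
  change ψ e (projIcc 0 (Γ.len e) (Γ.len_pos e).le t : ℝ) = ψ e t
  rw [projIcc_of_mem _ ht]

lemma continuous_lift [TopologicalSpace X] (hψ : ∀ e, Continuous (ψ e)) :
    Continuous (Γ.lift φ ψ h₀ h₁) := by
  let : TopologicalSpace V := ⊥
  have : DiscreteTopology V := ⟨rfl⟩
  refine continuous_quot_lift _ ?_
  change Continuous (X := V ⊕ Σ e : E, Icc (0 : ℝ) (Γ.len e)) _
  exact continuous_sum_dom.2 ⟨continuous_of_discreteTopology,
    continuous_sigma fun e => (hψ e).comp continuous_subtype_val⟩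

end lift

@[simp] lemma edgePoint_zero (e : E) : Γ.edgePoint e 0 = Γ.vertex (Γ.src e) := by
  refine (congrArg (fun p => Quot.mk Γ.Glue (Sum.inr ⟨e, p⟩)) ?_).trans (Quot.sound (Glue.src e))
  exact projIcc_left _

@[simp] lemma edgePoint_len (e : E) : Γ.edgePoint e (Γ.len e) = Γ.vertex (Γ.tgt e) := by
  refine (congrArg (fun p => Quot.mk Γ.Glue (Sum.inr ⟨e, p⟩)) ?_).trans (Quot.sound (Glue.tgt e))
  exact projIcc_right _

lemma edgePoint_projIcc (e : E) (t : ℝ) :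
    Γ.edgePoint e (projIcc 0 (Γ.len e) (Γ.len_pos e).le t) = Γ.edgePoint e t := by
  rw [edgePoint, edgePoint, projIcc_val]

variable (Γ) in
lemma continuous_edgePoint (e : E) : Continuous (Γ.edgePoint e) := by
  let : TopologicalSpace V := ⊥
  have h : Continuous (Y := V ⊕ Σ e : E, Icc (0 : ℝ) (Γ.len e))
      fun t => Sum.inr ⟨e, projIcc 0 (Γ.len e) (Γ.len_pos e).le t⟩ :=
    continuous_inr.comp (continuous_sigmaMk.comp continuous_projIcc)
  exact Continuous.comp (Y := Γ.PreSpace) continuous_quot_mk h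

/-- Every point is a vertex or an interior point of an edge. -/
lemma Space.cases {P : Γ.Space → Prop} (hv : ∀ v, P (Γ.vertex v))
    (he : ∀ e, ∀ t ∈ Ioo 0 (Γ.len e), P (Γ.edgePoint e t)) (x : Γ.Space) : P x := by
  obtain ⟨v | ⟨e, t, h0, h1⟩, rfl⟩ := Quot.exists_rep x
  · exact hv v
  · have hx : Quot.mk Γ.Glue (Sum.inr ⟨e, t, h0, h1⟩) = Γ.edgePoint e t := by
      rw [edgePoint, projIcc_of_mem _ ⟨h0, h1⟩]
    change P (Quot.mk Γ.Glue (Sum.inr ⟨e, t, h0, h1⟩))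
    rw [hx]
    rcases h0.eq_or_lt with rfl | h0
    · rw [edgePoint_zero]; exact hv _
    rcases h1.eq_or_lt with rfl | h1
    · rw [edgePoint_len]; exact hv _
    exact he e t ⟨h0, h1⟩

instance [Finite V] [Finite E] : CompactSpace Γ.Space := by
  let : TopologicalSpace V := ⊥
  have : CompactSpace Γ.PreSpace :=
    inferInstanceAs (CompactSpace (V ⊕ Σ e : E, Icc (0 : ℝ) (Γ.len e)))
  exact inferInstanceAs (CompactSpace (Quot Γ.Glue))

variable (Γ) in
open Classical in
/-- The position of a point: a vertex, or an edge with a parameter in its interior. -/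
noncomputable def position : Γ.Space → V ⊕ E × ℝ :=
  Γ.lift Sum.inl (fun e t => if t ≤ 0 then Sum.inl (Γ.src e) else
    if Γ.len e ≤ t then Sum.inl (Γ.tgt e) else Sum.inr (e, t)) (fun e => by simp)
    (fun e => by simp [(Γ.len_pos e)])

@[simp] lemma position_vertex (v : V) : Γ.position (Γ.vertex v) = Sum.inl v := rfl

lemma position_edgePoint {e : E} {t : ℝ} (ht : t ∈ Ioo 0 (Γ.len e)) :
    Γ.position (Γ.edgePoint e t) = Sum.inr (e, t) := by
  rw [position, lift_edgePoint (Ioo_subset_Icc_self ht), if_neg ht.1.not_ge, if_neg ht.2.not_ge]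

/-- `position` descends to the quotient, so it certifies that the gluing identifies nothing beyond
the end points of edges with their vertices. -/
lemma vertex_injective : Function.Injective Γ.vertex := fun u v h => by
  simpa using congrArg Γ.position h

lemma edgePoint_ne_vertex {e : E} {t : ℝ} (ht : t ∈ Ioo 0 (Γ.len e)) (v : V) :
    Γ.edgePoint e t ≠ Γ.vertex v := fun h => by
  simpa [position_edgePoint ht] using congrArg Γ.position h

lemma edgePoint_eq_iff {e e' : E} {t t' : ℝ} (ht : t ∈ Ioo 0 (Γ.len e))
    (ht' : t' ∈ Ioo 0 (Γ.len e')) : Γ.edgePoint e t = Γ.edgePoint e' t' ↔ e = e' ∧ t = t' := by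
  refine ⟨fun h => ?_, fun h => by rw [h.1, h.2]⟩
  simpa [position_edgePoint ht, position_edgePoint ht'] using congrArg Γ.position h

end Points

/-! ### From locally affine to affine on an interval -/

section LocallyAffine

/-- The derivative is locally constant on the open interval, hence constant there; continuity
carries the formula to the end points. -/
lemma exists_affine_of_locally_affine {φ : ℝ → ℝ} (hφ : Continuous φ) {a b : ℝ} (hab : a < b)
    (h : ∀ t ∈ Ioo a b, ∃ c : ℝ, ∀ᶠ s in 𝓝 t, φ s = φ t + c * (s - t)) :
    ∃ c : ℝ, ∀ s ∈ Icc a b, φ s = φ a + c * (s - a) := by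
  have hd : ∀ t ∈ Ioo a b, ∀ᶠ s in 𝓝 t, HasDerivAt φ (deriv φ t) s := by
    intro t ht
    obtain ⟨c, hc⟩ := h t ht
    have h1 : ∀ᶠ s in 𝓝 t, HasDerivAt φ c s := by
      filter_upwards [hc.eventually_nhds] with s hs
      have h2 : HasDerivAt (fun s => φ t + c * (s - t)) c s := by
        simpa using (((hasDerivAt_id s).sub_const t).const_mul c).const_add (φ t)
      exact h2.congr_of_eventuallyEq hs
    rwa [h1.self_of_nhds.deriv]
  have hdd : ∀ t ∈ Ioo a b, HasDerivAt (deriv φ) 0 t := fun t ht =>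
    (hasDerivAt_const t (deriv φ t)).congr_of_eventuallyEq ((hd t ht).mono fun s hs => hs.deriv)
  set m := (a + b) / 2 with hm
  have hmm : m ∈ Ioo a b := ⟨by linarith, by linarith⟩
  have hconst : ∀ t ∈ Ioo a b, deriv φ t = deriv φ m := fun t ht =>
    isOpen_Ioo.is_const_of_deriv_eq_zero isPreconnected_Ioo
      (fun s hs => (hdd s hs).differentiableAt.differentiableWithinAt)
      (fun s hs => (hdd s hs).deriv) ht hmm
  have hψd : ∀ t ∈ Ioo a b, HasDerivAt (fun s => φ s - deriv φ m * s) 0 t := fun t ht => by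
    have h1 := (hd t ht).self_of_nhds
    rw [hconst t ht] at h1
    simpa using h1.fun_sub ((hasDerivAt_id t).const_mul (deriv φ m))
  have hψ : EqOn (fun s => φ s - deriv φ m * s) (fun _ => φ m - deriv φ m * m) (Ioo a b) :=
    fun t ht => isOpen_Ioo.is_const_of_deriv_eq_zero isPreconnected_Ioo
      (fun s hs => (hψd s hs).differentiableAt.differentiableWithinAt)
      (fun s hs => (hψd s hs).deriv) ht hmm
  have hcl := hψ.closure (by fun_prop) (by fun_prop)
  rw [closure_Ioo hab.ne] at hcl
  refine ⟨deriv φ m, fun s hs => ?_⟩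
  have h1 := hcl hs
  have h2 := hcl (left_mem_Icc.2 hab.le)
  simp only at h1 h2
  linarith

end LocallyAffine


/-! ### Piecewise affine functions, their Laplacian, and uniqueness of the voltage -/

section PiecewiseAffine

variable {V E : Type*} {Γ : MetricGraph V E}

lemma slopeUp_eq {f : Γ.Space → ℝ} {e : E} {t a : ℝ}
    (h : ∀ᶠ s in 𝓝[≥] t, f (Γ.edgePoint e s) = f (Γ.edgePoint e t) + a * (s - t)) :
    Γ.slopeUp f e t = a := by
  have h1 : HasDerivWithinAt (fun s => f (Γ.edgePoint e t) + a * (s - t)) a (Ici t) t := by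
    simpa using (((hasDerivWithinAt_id t (Ici t)).sub_const t).const_mul a).const_add
      (f (Γ.edgePoint e t))
  exact (h1.congr_of_eventuallyEq h (by simp)).derivWithin (uniqueDiffWithinAt_Ici t)

lemma slopeDown_eq {f : Γ.Space → ℝ} {e : E} {t a : ℝ}
    (h : ∀ᶠ s in 𝓝[≤] t, f (Γ.edgePoint e s) = f (Γ.edgePoint e t) - a * (s - t)) :
    Γ.slopeDown f e t = a := by
  have h1 : HasDerivWithinAt (fun s => f (Γ.edgePoint e t) - a * (s - t)) (-a) (Iic t) t := by
    simpa using (((hasDerivWithinAt_id t (Iic t)).sub_const t).const_mul a).const_sub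
      (f (Γ.edgePoint e t))
  rw [slopeDown, (h1.congr_of_eventuallyEq h (by simp)).derivWithin (uniqueDiffWithinAt_Iic t),
    neg_neg]

variable [Fintype E]

variable (Γ) in
/-- `f` is continuous and piecewise affine, and `m p` is the mass of `Δ f` at the point `p`. -/
structure HasLaplacian (f m : Γ.Space → ℝ) : Prop where
  continuous : Continuous f
  right : ∀ e, ∀ t ∈ Ico 0 (Γ.len e), ∀ᶠ s in 𝓝[≥] t,
    f (Γ.edgePoint e s) = f (Γ.edgePoint e t) + Γ.slopeUp f e t * (s - t)
  left : ∀ e, ∀ t ∈ Ioc 0 (Γ.len e), ∀ᶠ s in 𝓝[≤] t,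
    f (Γ.edgePoint e s) = f (Γ.edgePoint e t) - Γ.slopeDown f e t * (s - t)
  interior : ∀ e, ∀ t ∈ Ioo 0 (Γ.len e),
    -(Γ.slopeUp f e t + Γ.slopeDown f e t) = m (Γ.edgePoint e t)
  vertices : ∀ v : V, -∑ e, (Γ.slopeUp f e 0 * pointMass (Γ.src e) v +
    Γ.slopeDown f e (Γ.len e) * pointMass (Γ.tgt e) v) = m (Γ.vertex v)

namespace HasLaplacian

variable {f g m n : Γ.Space → ℝ}

/-- The Laplacian of a function with prescribed one-sided slopes. -/
lemma of_slopes (up down : E → ℝ → ℝ) (hf : Continuous f)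
    (right : ∀ e, ∀ t ∈ Ico 0 (Γ.len e), ∀ᶠ s in 𝓝[≥] t,
      f (Γ.edgePoint e s) = f (Γ.edgePoint e t) + up e t * (s - t))
    (left : ∀ e, ∀ t ∈ Ioc 0 (Γ.len e), ∀ᶠ s in 𝓝[≤] t,
      f (Γ.edgePoint e s) = f (Γ.edgePoint e t) - down e t * (s - t))
    (interior : ∀ e, ∀ t ∈ Ioo 0 (Γ.len e), -(up e t + down e t) = m (Γ.edgePoint e t))
    (vertices : ∀ v : V, -∑ e, (up e 0 * pointMass (Γ.src e) v +
      down e (Γ.len e) * pointMass (Γ.tgt e) v) = m (Γ.vertex v)) : Γ.HasLaplacian f m := by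
  have hu : ∀ e, ∀ t ∈ Ico 0 (Γ.len e), Γ.slopeUp f e t = up e t := fun e t ht =>
    slopeUp_eq (right e t ht)
  have hd : ∀ e, ∀ t ∈ Ioc 0 (Γ.len e), Γ.slopeDown f e t = down e t := fun e t ht =>
    slopeDown_eq (left e t ht)
  refine ⟨hf, fun e t ht => ?_, fun e t ht => ?_, fun e t ht => ?_, fun v => ?_⟩
  · rw [hu e t ht]; exact right e t ht
  · rw [hd e t ht]; exact left e t ht
  · rw [hu e t (Ioo_subset_Ico_self ht), hd e t (Ioo_subset_Ioc_self ht)]; exact interior e t ht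
  · rw [← vertices v]
    congr 1
    refine Finset.sum_congr rfl fun e _ => ?_
    rw [hu e 0 ⟨le_rfl, Γ.len_pos e⟩, hd e _ ⟨Γ.len_pos e, le_rfl⟩]

/-- The affine germs recorded in `HasLaplacian` are what makes the slopes additive; `derivWithin`
alone has a default value where no derivative exists. -/
lemma combination (hf : Γ.HasLaplacian f m) (hg : Γ.HasLaplacian g n) (a b : ℝ) :
    Γ.HasLaplacian (fun x => a * f x + b * g x) (fun x => a * m x + b * n x) := by
  refine of_slopes (fun e t => a * Γ.slopeUp f e t + b * Γ.slopeUp g e t)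
    (fun e t => a * Γ.slopeDown f e t + b * Γ.slopeDown g e t)
    ((hf.continuous.const_mul a).add (hg.continuous.const_mul b)) ?_ ?_ ?_ ?_
  · intro e t ht
    filter_upwards [hf.right e t ht, hg.right e t ht] with s h1 h2
    rw [h1, h2]; ring
  · intro e t ht
    filter_upwards [hf.left e t ht, hg.left e t ht] with s h1 h2
    rw [h1, h2]; ring
  · intro e t ht
    rw [← hf.interior e t ht, ← hg.interior e t ht]; ring
  · intro v
    rw [← hf.vertices v, ← hg.vertices v, mul_neg, mul_neg, ← neg_add, Finset.mul_sum,
      Finset.mul_sum, ← Finset.sum_add_distrib]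
    congr 1
    exact Finset.sum_congr rfl fun e _ => by ring

lemma congr (hf : Γ.HasLaplacian f m) (h : ∀ x, f x = g x) (h' : ∀ x, m x = n x) :
    Γ.HasLaplacian g n := by
  rwa [← funext h, ← funext h']

lemma locally_affine (hf : Γ.HasLaplacian f m) {e : E} {t : ℝ} (ht : t ∈ Ioo 0 (Γ.len e))
    (hm : m (Γ.edgePoint e t) = 0) : ∃ a : ℝ, ∀ᶠ s in 𝓝 t,
      f (Γ.edgePoint e s) = f (Γ.edgePoint e t) + a * (s - t) := by
  refine ⟨Γ.slopeUp f e t, ?_⟩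
  have h := hf.interior e t ht
  rw [hm] at h
  have h' : Γ.slopeDown f e t = -Γ.slopeUp f e t := by linarith
  have hr := hf.right e t (Ioo_subset_Ico_self ht)
  have hl := hf.left e t (Ioo_subset_Ioc_self ht)
  rw [h'] at hl
  rw [← nhdsLE_sup_nhdsGE, Filter.eventually_sup]
  exact ⟨hl.mono fun s hs => by rw [hs]; ring, hr⟩

/-- A piecewise affine function whose Laplacian is supported at the vertices is affine on the
edges, and its Laplacian is given by the graph Laplacian. -/
lemma of_interior_eq_zero (hf : Γ.HasLaplacian f m)
    (hm : ∀ e, ∀ t ∈ Ioo 0 (Γ.len e), m (Γ.edgePoint e t) = 0) :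
    (∀ e, ∀ t ∈ Icc 0 (Γ.len e), f (Γ.edgePoint e t) = f (Γ.vertex (Γ.src e)) +
      (f (Γ.vertex (Γ.tgt e)) - f (Γ.vertex (Γ.src e))) / Γ.len e * t) ∧
    ∀ v, Γ.lap (fun v => f (Γ.vertex v)) v = m (Γ.vertex v) := by
  have haff : ∀ e, ∀ t ∈ Icc 0 (Γ.len e), f (Γ.edgePoint e t) = f (Γ.vertex (Γ.src e)) +
      (f (Γ.vertex (Γ.tgt e)) - f (Γ.vertex (Γ.src e))) / Γ.len e * t := by
    intro e
    obtain ⟨c, hc⟩ := exists_affine_of_locally_affine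
      (hf.continuous.comp (Γ.continuous_edgePoint e)) (Γ.len_pos e)
      (fun t ht => hf.locally_affine ht (hm e t ht))
    simp only [Function.comp_apply, edgePoint_zero, sub_zero] at hc
    have hc' : (f (Γ.vertex (Γ.tgt e)) - f (Γ.vertex (Γ.src e))) / Γ.len e = c := by
      have := hc _ (right_mem_Icc.2 (Γ.len_pos e).le)
      rw [edgePoint_len] at this
      rw [this, add_sub_cancel_left, mul_div_cancel_right₀ _ (Γ.len_pos e).ne']
    rw [hc']
    exact hc
  refine ⟨haff, fun v => ?_⟩
  rw [← hf.vertices v, lap_apply, ← Finset.sum_neg_distrib]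
  refine Finset.sum_congr rfl fun e _ => ?_
  have hu : Γ.slopeUp f e 0 = (f (Γ.vertex (Γ.tgt e)) - f (Γ.vertex (Γ.src e))) / Γ.len e := by
    refine slopeUp_eq ?_
    filter_upwards [Icc_mem_nhdsGE (Γ.len_pos e)] with s hs
    rw [haff e s hs, edgePoint_zero, sub_zero]
  have hd : Γ.slopeDown f e (Γ.len e) =
      -((f (Γ.vertex (Γ.tgt e)) - f (Γ.vertex (Γ.src e))) / Γ.len e) := by
    refine slopeDown_eq ?_
    filter_upwards [Icc_mem_nhdsLE (Γ.len_pos e)] with s hs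
    rw [haff e s hs, haff e _ (right_mem_Icc.2 (Γ.len_pos e).le)]
    ring
  rw [hu, hd]; ring

/-- A harmonic function is constant. -/
lemma eq_of_eq_zero [Fintype V] (hΓ : Γ.Connected) (hf : Γ.HasLaplacian f fun _ => 0)
    (x y : Γ.Space) : f x = f y := by
  obtain ⟨h1, h2⟩ := hf.of_interior_eq_zero fun _ _ _ => rfl
  have hv : ∀ u v, f (Γ.vertex u) = f (Γ.vertex v) := fun u v =>
    hΓ.eq_of_lap_eq_zero (H := fun v => f (Γ.vertex v)) (funext h2) u v
  have hx : ∀ u x, f x = f (Γ.vertex u) := fun u x => by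
    induction x using Space.cases with
    | hv v => exact hv v u
    | he e t ht =>
      rw [h1 e t (Ioo_subset_Icc_self ht), hv (Γ.tgt e) (Γ.src e), sub_self, zero_div, zero_mul,
        add_zero, hv]
  induction y using Space.cases with
  | hv v => exact hx v x
  | he e t ht => rw [hx (Γ.src e) x, hx (Γ.src e) (Γ.edgePoint e t)]

end HasLaplacian

omit [Fintype E] in
lemma source_eq (z y p : Γ.Space) : Γ.source z y p = pointMass y p - pointMass z p := rfl

/-- The poles occupy at most two interior parameters of an edge, so on a short one-sided interval at
any `t` the voltage is locally affine, hence affine up to `t` itself. -/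
lemma IsVoltage.hasLaplacian {z y : Γ.Space} {f : Γ.Space → ℝ} (hf : Γ.IsVoltage z y f) :
    Γ.HasLaplacian f (Γ.source z y) := by
  have hbad : ∀ e, ({t ∈ Ioo 0 (Γ.len e) | Γ.edgePoint e t = y ∨ Γ.edgePoint e t = z}).Finite := by
    intro e
    have hsub : ∀ w, ({t ∈ Ioo 0 (Γ.len e) | Γ.edgePoint e t = w}).Finite := fun w =>
      Set.Subsingleton.finite fun t ht t' ht' =>
        ((edgePoint_eq_iff ht.1 ht'.1).1 (ht.2.trans ht'.2.symm)).2
    refine ((hsub y).union (hsub z)).subset ?_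
    rintro t ⟨h1, h2 | h2⟩
    exacts [Or.inl ⟨h1, h2⟩, Or.inr ⟨h1, h2⟩]
  have hnhds : ∀ e t, ∀ᶠ s in 𝓝 t, s ≠ t → s ∈ Ioo 0 (Γ.len e) →
      Γ.edgePoint e s ≠ y ∧ Γ.edgePoint e s ≠ z := by
    intro e t
    have h := ((hbad e).subset (sdiff_subset (t := {t}))).isClosed.isOpen_compl.mem_nhds
      (show t ∈ _ from fun h => h.2 rfl)
    filter_upwards [h] with s hs hst hs'
    by_contra hc
    exact hs ⟨⟨hs', by tauto⟩, hst⟩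
  have hcont : ∀ e, Continuous fun s => f (Γ.edgePoint e s) := fun e =>
    hf.continuous.comp (Γ.continuous_edgePoint e)
  refine ⟨hf.continuous, fun e t ht => ?_, fun e t ht => ?_, hf.interior, fun v => ?_⟩
  · obtain ⟨b, hb, hb'⟩ := (mem_nhdsGE_iff_exists_Icc_subset).1
      (nhdsWithin_le_nhds (s := Ici t) ((hnhds e t).and (Iio_mem_nhds ht.2)))
    obtain ⟨c, hc⟩ := exists_affine_of_locally_affine (hcont e) hb fun s hs => by
      have h1 := hb' (Ioo_subset_Icc_self hs)
      have hs' : s ∈ Ioo 0 (Γ.len e) := ⟨ht.1.trans_lt hs.1, h1.2⟩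
      have h2 := h1.1 hs.1.ne' hs'
      exact hf.affine e s hs' h2.1 h2.2
    have h3 : ∀ᶠ s in 𝓝[≥] t, f (Γ.edgePoint e s) = f (Γ.edgePoint e t) + c * (s - t) := by
      filter_upwards [Icc_mem_nhdsGE hb] with s hs using hc s hs
    rwa [slopeUp_eq h3]
  · obtain ⟨b, hb, hb'⟩ := (mem_nhdsLE_iff_exists_Icc_subset).1
      (nhdsWithin_le_nhds (s := Iic t) ((hnhds e t).and (Ioi_mem_nhds ht.1)))
    obtain ⟨c, hc⟩ := exists_affine_of_locally_affine (hcont e) hb fun s hs => by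
      have h1 := hb' (Ioo_subset_Icc_self hs)
      have hs' : s ∈ Ioo 0 (Γ.len e) := ⟨h1.2, hs.2.trans_le ht.2⟩
      have h2 := h1.1 hs.2.ne hs'
      exact hf.affine e s hs' h2.1 h2.2
    have h3 : ∀ᶠ s in 𝓝[≤] t, f (Γ.edgePoint e s) = f (Γ.edgePoint e t) - -c * (s - t) := by
      filter_upwards [Icc_mem_nhdsLE hb] with s hs
      rw [hc s hs, hc t (right_mem_Icc.2 (le_of_lt hb))]; ring
    rwa [slopeDown_eq h3]
  · rw [← hf.vertices v, Finset.sum_add_distrib]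
    simp only [mul_pointMass]

lemma HasLaplacian.isVoltage {z y : Γ.Space} {f : Γ.Space → ℝ}
    (hf : Γ.HasLaplacian f (Γ.source z y)) (hz : f z = 0) : Γ.IsVoltage z y f where
  continuous := hf.continuous
  ground := hz
  affine e t ht hy hz := hf.locally_affine ht (by simp [source, hy, hz])
  interior := hf.interior
  vertices v := by
    rw [← hf.vertices v, Finset.sum_add_distrib]
    simp only [mul_pointMass]

lemma IsVoltage.unique [Fintype V] (hΓ : Γ.Connected) {z y : Γ.Space} {f g : Γ.Space → ℝ}
    (hf : Γ.IsVoltage z y f) (hg : Γ.IsVoltage z y g) : f = g := by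
  have h := (hf.hasLaplacian.combination hg.hasLaplacian 1 (-1)).congr (g := fun x => f x - g x)
    (n := fun _ => 0) (fun x => by ring) (fun x => by ring)
  ext x
  have := h.eq_of_eq_zero hΓ x z
  simp only [hf.ground, hg.ground] at this
  linarith

/-- `voltage` is chosen by `Classical.epsilon`; uniqueness lets any exhibited voltage function
replace it. -/
lemma IsVoltage.voltage_eq [Fintype V] (hΓ : Γ.Connected) {z y : Γ.Space} {f : Γ.Space → ℝ}
    (hf : Γ.IsVoltage z y f) (x : Γ.Space) : Γ.voltage z x y = f x :=
  congrFun (IsVoltage.unique hΓ (Classical.epsilon_spec (p := Γ.IsVoltage z y) ⟨f, hf⟩) hf) x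

end PiecewiseAffine


/-! ### The Green's function on all points, and the voltage in terms of it -/

section Green

variable {V E : Type*} (Γ : MetricGraph V E)

/-- The extension of a function on the vertices which is affine along the edges. -/
noncomputable def interp : (V → ℝ) →ₗ[ℝ] (Γ.Space → ℝ) where
  toFun H := Γ.lift H (fun e t => H (Γ.src e) + (H (Γ.tgt e) - H (Γ.src e)) / Γ.len e * t)
    (fun e => by simp) (fun e => by
      rw [div_mul_cancel₀ _ (Γ.len_pos e).ne']; ring)
  map_add' H H' := by
    ext x
    induction x using Space.cases with
    | hv v => simp
    | he e t ht =>
      simp only [Pi.add_apply, lift_edgePoint (Ioo_subset_Icc_self ht)]; ring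
  map_smul' c H := by
    ext x
    induction x using Space.cases with
    | hv v => simp
    | he e t ht =>
      simp only [Pi.smul_apply, smul_eq_mul, RingHom.id_apply,
        lift_edgePoint (Ioo_subset_Icc_self ht)]
      ring

/-- The Green's function of the edge `e` with Dirichlet boundary conditions and pole at the
parameter `t`, extended by zero. -/
noncomputable def tent (e : E) (t : ℝ) : Γ.Space → ℝ :=
  -- The pole is clamped to `[0, len e]`: only then does the tent vanish at both ends, as the gluing
  -- requires.
  Γ.lift (fun _ => 0) (fun e' s => pointMass e e' *
      (min s (projIcc 0 (Γ.len e) (Γ.len_pos e).le t) -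
        s * projIcc 0 (Γ.len e) (Γ.len_pos e).le t / Γ.len e))
    (fun e' => by simp [(projIcc 0 (Γ.len e) (Γ.len_pos e).le t).2.1])
    (fun e' => by
      by_cases h : e' = e
      · subst h
        rw [min_eq_right (projIcc 0 (Γ.len e') (Γ.len_pos e').le t).2.2,
          mul_div_cancel_left₀ _ (Γ.len_pos e').ne', sub_self, mul_zero]
      · simp [pointMass_of_ne h])

variable {Γ}

@[simp] lemma interp_vertex (H : V → ℝ) (v : V) : Γ.interp H (Γ.vertex v) = H v := rfl

lemma interp_edgePoint (H : V → ℝ) {e : E} {t : ℝ} (ht : t ∈ Icc 0 (Γ.len e)) :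
    Γ.interp H (Γ.edgePoint e t) =
      H (Γ.src e) + (H (Γ.tgt e) - H (Γ.src e)) / Γ.len e * t := by
  simp only [interp, LinearMap.coe_mk, AddHom.coe_mk, lift_edgePoint ht]

lemma continuous_interp (H : V → ℝ) : Continuous (Γ.interp H) := by
  simp only [interp, LinearMap.coe_mk, AddHom.coe_mk]
  exact continuous_lift fun e => by fun_prop

@[simp] lemma tent_vertex (e : E) (t : ℝ) (v : V) : Γ.tent e t (Γ.vertex v) = 0 := rfl

lemma tent_edgePoint {e : E} {s t : ℝ} (ht : t ∈ Icc 0 (Γ.len e)) (hs : s ∈ Icc 0 (Γ.len e)) :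
    Γ.tent e t (Γ.edgePoint e s) = min s t - s * t / Γ.len e := by
  rw [tent, lift_edgePoint hs, pointMass_self, one_mul, projIcc_of_mem _ ht]

lemma tent_edgePoint_of_ne {e e' : E} (h : e' ≠ e) (t s : ℝ) :
    Γ.tent e t (Γ.edgePoint e' s) = 0 := by
  rw [← edgePoint_projIcc, tent, lift_edgePoint (Subtype.prop _), pointMass_of_ne h, zero_mul]

lemma continuous_tent (e : E) (t : ℝ) : Continuous (Γ.tent e t) :=
  continuous_lift fun e => by fun_prop

lemma tent_zero (e : E) : Γ.tent e 0 = fun _ => 0 := by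
  ext x
  induction x using Space.cases with
  | hv v => rfl
  | he e' s hs =>
    by_cases h : e' = e
    · subst h
      rw [tent_edgePoint (left_mem_Icc.2 (Γ.len_pos e').le) (Ioo_subset_Icc_self hs),
        min_eq_right hs.1.le]
      simp
    · exact tent_edgePoint_of_ne h _ _

lemma tent_len (e : E) : Γ.tent e (Γ.len e) = fun _ => 0 := by
  ext x
  induction x using Space.cases with
  | hv v => rfl
  | he e' s hs =>
    by_cases h : e' = e
    · subst h
      rw [tent_edgePoint (right_mem_Icc.2 (Γ.len_pos e').le) (Ioo_subset_Icc_self hs),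
        min_eq_left hs.2.le, mul_div_cancel_right₀ _ (Γ.len_pos e').ne', sub_self]
    · exact tent_edgePoint_of_ne h _ _

variable (Γ) in
/-- The function `x ↦ tent e t x`, where `y` is the point with parameter `t` of the edge `e`. -/
noncomputable def bubble : Γ.Space → Γ.Space → ℝ :=
  Γ.lift (fun _ _ => 0) Γ.tent tent_zero tent_len

@[simp] lemma bubble_vertex (v : V) : Γ.bubble (Γ.vertex v) = fun _ => 0 := rfl

lemma bubble_edgePoint {e : E} {t : ℝ} (ht : t ∈ Icc 0 (Γ.len e)) :
    Γ.bubble (Γ.edgePoint e t) = Γ.tent e t := lift_edgePoint ht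

variable (Γ) in
/-- The extension of a Green's function of the graph Laplacian to all points. -/
noncomputable def green (G : V → V → ℝ) (x y : Γ.Space) : ℝ :=
  Γ.interp (fun v => Γ.interp (G v) y) x + Γ.bubble y x

@[simp] lemma green_vertex_left (G : V → V → ℝ) (u : V) (y : Γ.Space) :
    Γ.green G (Γ.vertex u) y = Γ.interp (G u) y := by
  rw [green, interp_vertex]
  induction y using Space.cases with
  | hv v => simp
  | he e t ht => simp [bubble_edgePoint (Ioo_subset_Icc_self ht)]

variable {o : V} {G : V → V → ℝ}

lemma tent_comm {e e' : E} {s t : ℝ} (ht : t ∈ Icc 0 (Γ.len e)) (hs : s ∈ Icc 0 (Γ.len e')) :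
    Γ.tent e t (Γ.edgePoint e' s) = Γ.tent e' s (Γ.edgePoint e t) := by
  by_cases h : e' = e
  · subst h
    rw [tent_edgePoint ht hs, tent_edgePoint hs ht, min_comm, mul_comm]
  · rw [tent_edgePoint_of_ne h, tent_edgePoint_of_ne (Ne.symm h)]

variable [Fintype E]

namespace IsGreen

variable (hG : Γ.IsGreen o G)

include hG

lemma green_comm (x y : Γ.Space) : Γ.green G x y = Γ.green G y x := by
  have hv : ∀ v x, Γ.green G x (Γ.vertex v) = Γ.interp (G v) x := fun v x => by
    simp only [green, interp_vertex, bubble_vertex, add_zero]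
    exact congrArg (fun H => Γ.interp H x) (funext fun u => hG.symm u v)
  induction y using Space.cases with
  | hv v => rw [hv, green_vertex_left]
  | he e t ht =>
    induction x using Space.cases with
    | hv v => rw [hv, green_vertex_left]
    | he e' s hs =>
      have ht := Ioo_subset_Icc_self ht
      have hs := Ioo_subset_Icc_self hs
      simp only [green, bubble_edgePoint ht, bubble_edgePoint hs, tent_comm ht hs,
        interp_edgePoint _ ht, interp_edgePoint _ hs]
      rw [hG.symm (Γ.src e) (Γ.src e'), hG.symm (Γ.src e) (Γ.tgt e'),
        hG.symm (Γ.tgt e) (Γ.src e'), hG.symm (Γ.tgt e) (Γ.tgt e')]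
      ring

lemma green_vertex_right (x : Γ.Space) (v : V) :
    Γ.green G x (Γ.vertex v) = Γ.interp (G v) x := by
  rw [hG.green_comm, green_vertex_left]

lemma green_edgePoint (x : Γ.Space) {e : E} {t : ℝ} (ht : t ∈ Icc 0 (Γ.len e)) :
    Γ.green G x (Γ.edgePoint e t) = Γ.interp (G (Γ.src e)) x +
      (Γ.interp (G (Γ.tgt e)) x - Γ.interp (G (Γ.src e)) x) / Γ.len e * t + Γ.tent e t x := by
  have h : (fun v => Γ.interp (G v) (Γ.edgePoint e t)) =
      G (Γ.src e) + (t / Γ.len e) • (G (Γ.tgt e) - G (Γ.src e)) := by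
    ext v
    simp only [interp_edgePoint _ ht, Pi.add_apply, Pi.smul_apply, Pi.sub_apply, smul_eq_mul,
      hG.symm v]
    ring
  rw [green, h, bubble_edgePoint ht]
  simp only [map_add, map_smul, map_sub, Pi.add_apply, Pi.smul_apply, Pi.sub_apply, smul_eq_mul]
  ring

end IsGreen

/-- The density of the canonical measure along the edge `e`. -/
noncomputable def density (Γ : MetricGraph V E) (G : V → V → ℝ) (e : E) : ℝ :=
  (Γ.len e - Γ.greenRes G e) / Γ.len e ^ 2

variable (Γ) in
/-- The function which is `c e * t * (len e - t)` at the parameter `t` of the edge `e`. -/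
noncomputable def parabola (c : E → ℝ) : Γ.Space → ℝ :=
  Γ.lift (fun _ => 0) (fun e t => c e * (t * (Γ.len e - t))) (by simp) (by simp)

omit [Fintype E] in
@[simp] lemma parabola_vertex (c : E → ℝ) (v : V) : Γ.parabola c (Γ.vertex v) = 0 := rfl

omit [Fintype E] in
lemma parabola_edgePoint (c : E → ℝ) {e : E} {t : ℝ} (ht : t ∈ Icc 0 (Γ.len e)) :
    Γ.parabola c (Γ.edgePoint e t) = c e * (t * (Γ.len e - t)) := lift_edgePoint ht

omit [Fintype E] in
lemma continuous_parabola (c : E → ℝ) : Continuous (Γ.parabola c) :=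
  continuous_lift fun e => by fun_prop

/-- Interpolating in both variables makes the diagonal quadratic along an edge, and the tent adds `t
- t² / L`. The deviation from the interpolated vertex values has exactly the coefficient `density`.
-/
lemma IsGreen.green_self (hG : Γ.IsGreen o G) (x : Γ.Space) :
    Γ.green G x x = Γ.interp (fun v => G v v) x + Γ.parabola (Γ.density G) x := by
  induction x using Space.cases with
  | hv v => simp
  | he e t ht =>
    have ht := Ioo_subset_Icc_self ht
    have hL := (Γ.len_pos e).ne'
    rw [hG.green_edgePoint _ ht, interp_edgePoint _ ht, interp_edgePoint _ ht,
      interp_edgePoint _ ht, tent_edgePoint ht ht, parabola_edgePoint _ ht, min_self, density,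
      greenRes, hG.symm (Γ.tgt e) (Γ.src e)]
    field_simp
    ring

lemma hasLaplacian_interp {H : V → ℝ} {m : Γ.Space → ℝ}
    (hm : ∀ e, ∀ t ∈ Ioo 0 (Γ.len e), m (Γ.edgePoint e t) = 0)
    (hv : ∀ v, Γ.lap H v = m (Γ.vertex v)) : Γ.HasLaplacian (Γ.interp H) m := by
  refine .of_slopes (fun e _ => (H (Γ.tgt e) - H (Γ.src e)) / Γ.len e)
    (fun e _ => -((H (Γ.tgt e) - H (Γ.src e)) / Γ.len e)) (continuous_interp H) ?_ ?_ ?_ ?_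
  · intro e t ht
    filter_upwards [Icc_mem_nhdsGE ht.2] with s hs
    rw [interp_edgePoint _ (Ico_subset_Icc_self ht), interp_edgePoint _ ⟨ht.1.trans hs.1, hs.2⟩]
    ring
  · intro e t ht
    filter_upwards [Icc_mem_nhdsLE ht.1] with s hs
    rw [interp_edgePoint _ (Ioc_subset_Icc_self ht), interp_edgePoint _ ⟨hs.1, hs.2.trans ht.2⟩]
    ring
  · intro e t ht
    rw [hm e t ht]; ring
  · intro v
    rw [← hv, lap_apply, ← Finset.sum_neg_distrib]
    exact Finset.sum_congr rfl fun e _ => by ring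

lemma hasLaplacian_tent (e : E) {t : ℝ} (ht : t ∈ Ioo 0 (Γ.len e)) :
    Γ.HasLaplacian (Γ.tent e t) (fun x => pointMass (Γ.edgePoint e t) x -
      ((1 - t / Γ.len e) * pointMass (Γ.vertex (Γ.src e)) x +
        t / Γ.len e * pointMass (Γ.vertex (Γ.tgt e)) x)) := by
  classical
  have hL := (Γ.len_pos e).ne'
  have ht' := Ioo_subset_Icc_self ht
  refine .of_slopes
    -- The strict inequality in the right slope and the weak one in the left slope differ only at `s
    -- = t`, which creates the unit mass there.
    (fun e' s => pointMass e e' * ((if s < t then 1 else 0) - t / Γ.len e))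
    (fun e' s => pointMass e e' * (t / Γ.len e - (if s ≤ t then 1 else 0)))
    (continuous_tent e t) ?_ ?_ ?_ ?_
  · intro e' s hs
    by_cases h : e' = e
    swap
    · simp [tent_edgePoint_of_ne h, pointMass_of_ne h]
    subst h
    have hs' := Ico_subset_Icc_self hs
    by_cases hst : s < t
    · filter_upwards [Icc_mem_nhdsGE hst, Icc_mem_nhdsGE hs.2] with r hr hr'
      rw [tent_edgePoint ht' hs', tent_edgePoint ht' ⟨hs.1.trans hr.1, hr'.2⟩, min_eq_left hr.2,
        min_eq_left hst.le, if_pos hst, pointMass_self]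
      ring
    · filter_upwards [Icc_mem_nhdsGE hs.2] with r hr'
      have hst := not_lt.1 hst
      rw [tent_edgePoint ht' hs', tent_edgePoint ht' ⟨hs.1.trans hr'.1, hr'.2⟩,
        min_eq_right (hst.trans hr'.1), min_eq_right hst, if_neg hst.not_gt, pointMass_self]
      ring
  · intro e' s hs
    by_cases h : e' = e
    swap
    · simp [tent_edgePoint_of_ne h, pointMass_of_ne h]
    subst h
    have hs' := Ioc_subset_Icc_self hs
    by_cases hst : s ≤ t
    · filter_upwards [Icc_mem_nhdsLE hs.1] with r hr'
      rw [tent_edgePoint ht' hs', tent_edgePoint ht' ⟨hr'.1, hr'.2.trans hs.2⟩,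
        min_eq_left (hr'.2.trans hst), min_eq_left hst, if_pos hst, pointMass_self]
      ring
    · have hst' := not_le.1 hst
      filter_upwards [Icc_mem_nhdsLE hst', Icc_mem_nhdsLE hs.1] with r hr hr'
      rw [tent_edgePoint ht' hs', tent_edgePoint ht' ⟨hr'.1, hr'.2.trans hs.2⟩,
        min_eq_right hr.1, min_eq_right hst'.le, if_neg hst, pointMass_self]
      ring
  · intro e' s hs
    rw [pointMass_of_ne (edgePoint_ne_vertex hs _), pointMass_of_ne (edgePoint_ne_vertex hs _)]
    by_cases h : e' = e ∧ s = t
    · obtain ⟨rfl, rfl⟩ := h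
      simp
    · rw [pointMass_of_ne fun h' => h ((edgePoint_eq_iff hs ht).1 h')]
      by_cases h' : e' = e
      · have hst : s ≠ t := fun h'' => h ⟨h', h''⟩
        rcases hst.lt_or_gt with hst | hst
        · rw [if_pos hst, if_pos hst.le]; ring
        · simp [hst.not_ge, hst.not_gt]
      · simp [pointMass_of_ne h']
  · intro v
    rw [pointMass_of_ne (edgePoint_ne_vertex ht v).symm, pointMass_comp vertex_injective,
      pointMass_comp vertex_injective]
    have h : ∀ e', pointMass e e' * ((if 0 < t then 1 else 0) - t / Γ.len e) *
        pointMass (Γ.src e') v + pointMass e e' *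
          (t / Γ.len e - if Γ.len e' ≤ t then 1 else 0) * pointMass (Γ.tgt e') v =
        ((1 - t / Γ.len e) * pointMass (Γ.src e') v +
          (t / Γ.len e - if Γ.len e' ≤ t then 1 else 0) * pointMass (Γ.tgt e') v) *
          pointMass e e' := fun e' => by rw [if_pos ht.1]; ring
    simp only [h, sum_mul_pointMass, if_neg ht.2.not_ge]
    ring

/-- `Γ.green G` is a Green's function of the Laplacian on all of `Γ`. -/
lemma IsGreen.hasLaplacian (hG : Γ.IsGreen o G) (y : Γ.Space) :
    Γ.HasLaplacian (fun x => Γ.green G x y)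
      (fun x => pointMass y x - pointMass (Γ.vertex o) x) := by
  induction y using Space.cases with
  | hv v =>
    simp only [hG.green_vertex_right]
    refine hasLaplacian_interp (fun e t ht => ?_) fun u => ?_
    · simp [pointMass_of_ne (edgePoint_ne_vertex ht _)]
    · rw [pointMass_comp vertex_injective, pointMass_comp vertex_injective, hG.lap_eq]
  | he e t ht =>
    have ht' := Ioo_subset_Icc_self ht
    -- The interpolated part puts at the two ends of `e` exactly the masses that the tent removes.
    have h1 : Γ.HasLaplacian
        (Γ.interp (G (Γ.src e) + (t / Γ.len e) • (G (Γ.tgt e) - G (Γ.src e))))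
        (fun x => (1 - t / Γ.len e) * pointMass (Γ.vertex (Γ.src e)) x +
          t / Γ.len e * pointMass (Γ.vertex (Γ.tgt e)) x - pointMass (Γ.vertex o) x) := by
      refine hasLaplacian_interp (fun e t ht => ?_) fun u => ?_
      · simp [pointMass_of_ne (edgePoint_ne_vertex ht _)]
      · simp only [pointMass_comp vertex_injective, map_add, map_smul, map_sub, Pi.add_apply,
          Pi.smul_apply, Pi.sub_apply, smul_eq_mul, hG.lap_eq]
        ring
    refine (h1.combination (hasLaplacian_tent e ht) 1 1).congr (fun x => ?_) fun x => by ring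
    rw [hG.green_edgePoint x ht']
    simp only [map_add, map_smul, map_sub, Pi.add_apply, Pi.smul_apply, Pi.sub_apply, smul_eq_mul]
    ring

lemma IsGreen.isVoltage (hG : Γ.IsGreen o G) (z y : Γ.Space) :
    Γ.IsVoltage z y fun x => Γ.green G x y - Γ.green G x z - (Γ.green G z y - Γ.green G z z) := by
  have h1 : Γ.HasLaplacian (fun _ => 1) fun _ => 0 := by
    refine .of_slopes (fun _ _ => 0) (fun _ _ => 0) continuous_const ?_ ?_ ?_ ?_ <;> simp
  refine HasLaplacian.isVoltage ((((hG.hasLaplacian y).combination (hG.hasLaplacian z)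
    1 (-1)).combination h1 1 (-(Γ.green G z y - Γ.green G z z))).congr
      (fun x => ?_) fun x => ?_) ?_
  · ring
  · rw [source_eq]; ring
  · ring

lemma IsGreen.voltage_eq [Fintype V] (hΓ : Γ.Connected) (hG : Γ.IsGreen o G) (z x y : Γ.Space) :
    Γ.voltage z x y =
      Γ.green G x y - Γ.green G x z - (Γ.green G z y - Γ.green G z z) :=
  (hG.isVoltage z y).voltage_eq hΓ x

lemma IsGreen.resistance_eq [Fintype V] (hΓ : Γ.Connected) (hG : Γ.IsGreen o G)
    (x y : Γ.Space) :
    Γ.resistance x y = Γ.green G x x + Γ.green G y y - 2 * Γ.green G x y := by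
  rw [resistance, hG.voltage_eq hΓ, hG.green_comm y x]; ring

end Green

/-! ### The coefficient `1 / (L + R)` of an edge -/

section EdgeResistance

variable {V E : Type*} {Γ : MetricGraph V E}

lemma Connected.of_deleteEdge_eqvGen (hΓ : Γ.Connected) {e : E}
    (h : Relation.EqvGen (fun a b => ∃ e', (Γ.deleteEdge e).src e' = a ∧ (Γ.deleteEdge e).tgt e' = b)
      (Γ.src e) (Γ.tgt e)) : (Γ.deleteEdge e).Connected := fun u v => by
  induction hΓ u v with
  | rel x y hxy =>
    obtain ⟨e', rfl, rfl⟩ := hxy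
    by_cases he : e' = e
    · rw [he]; exact h
    · exact .rel _ _ ⟨⟨e', he⟩, rfl, rfl⟩
  | refl x => exact .refl x
  | symm x y _ ih => exact ih.symm
  | trans x y z _ _ ih1 ih2 => exact ih1.trans _ _ _ ih2

variable [Fintype E]

variable (Γ) in
-- The `Fintype` instance is arbitrary, so the lemma applies to whichever one the deleted graph
-- carries.
lemma lap_deleteEdge (e : E) [inst : Fintype {e' : E // e' ≠ e}] (H : V → ℝ) (v : V) :
    Γ.lap H v = (Γ.deleteEdge e).lap H v + (H (Γ.tgt e) - H (Γ.src e)) / Γ.len e *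
      (pointMass (Γ.tgt e) v - pointMass (Γ.src e) v) := by
  classical
  obtain rfl : inst = Subtype.fintype _ := Subsingleton.elim _ _
  rw [lap_apply, lap_apply, Fintype.sum_eq_add_sum_subtype_ne _ e, add_comm]
  congr 1

variable [Fintype V]

lemma Connected.resistance_vertex (hΓ : Γ.Connected) (a b : V) :
    0 ≤ Γ.resistance (Γ.vertex a) (Γ.vertex b) ∧ ∃ H : V → ℝ,
      (∀ v, Γ.lap H v = pointMass b v - pointMass a v) ∧
        H b - H a = Γ.resistance (Γ.vertex a) (Γ.vertex b) := by
  obtain ⟨G, hG⟩ := hΓ.exists_isGreen a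
  have hlap : ∀ v, Γ.lap (G b - G a) v = pointMass b v - pointMass a v := fun v => by
    simp [hG.lap_eq]
  have hr : (G b - G a) b - (G b - G a) a = Γ.resistance (Γ.vertex a) (Γ.vertex b) := by
    rw [hG.resistance_eq hΓ]
    simp only [Pi.sub_apply, green_vertex_left, interp_vertex, hG.symm b a]
    ring
  refine ⟨?_, _, hlap, hr⟩
  have h := Γ.sum_mul_lap_self_nonneg (G b - G a)
  simp only [hlap, mul_sub, Finset.sum_sub_distrib, sum_mul_pointMass] at h
  rwa [← hr]

/-- The coefficient `1 / (L + R)` of an edge in terms of a Green's function. -/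
lemma IsGreen.inv_len_add_edgeResistance (hΓ : Γ.Connected) {o : V} {G : V → V → ℝ}
    (hG : Γ.IsGreen o G) (e : E) :
    ((ENNReal.ofReal (Γ.len e) + Γ.edgeResistance e)⁻¹).toReal = Γ.density G e := by
  classical
  have hL := Γ.len_pos e
  by_cases hc : (Γ.deleteEdge e).Connected
  · obtain ⟨hR, H, hH, hHR⟩ := hc.resistance_vertex (Γ.src e) (Γ.tgt e)
    rw [edgeResistance, if_pos hc]
    set R := (Γ.deleteEdge e).resistance ((Γ.deleteEdge e).vertex (Γ.src e))
      ((Γ.deleteEdge e).vertex (Γ.tgt e)) with hRdef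
    have hk : 1 + R / Γ.len e ≠ 0 := by positivity
    -- A voltage driving unit current through `Γ - e` drops by `R`, so restoring `e` adds a current
    -- `R / L`. Normalizing to unit current in `Γ` gives the parallel law `ρ = L R / (L + R)`.
    have hd := hG.drop_eq hΓ (H := (1 + R / Γ.len e)⁻¹ • H) (a := Γ.src e) (b := Γ.tgt e)
      fun v => by
        rw [map_smul, Pi.smul_apply, smul_eq_mul, Γ.lap_deleteEdge e H v, hHR, hH v]
        field_simp
    rw [← ENNReal.ofReal_add hL.le hR, ENNReal.toReal_inv,
      ENNReal.toReal_ofReal (add_nonneg hL.le hR), density, greenRes, ← hd]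
    simp only [Pi.smul_apply, smul_eq_mul, ← mul_sub, hHR]
    have : Γ.len e + R ≠ 0 := by positivity
    field_simp
    ring
  · rw [edgeResistance, if_neg hc, add_top, ENNReal.inv_top, ENNReal.toReal_zero]
    let r : V → V → Prop := fun a b =>
      ∃ e', (Γ.deleteEdge e).src e' = a ∧ (Γ.deleteEdge e).tgt e' = b
    -- For a bridge all the current runs through `e`: this step function is its voltage, the drop is
    -- `L`, and the density is 0.
    let H : V → ℝ := fun v => if Relation.EqvGen r (Γ.src e) v then 0 else Γ.len e
    have hs : H (Γ.src e) = 0 := if_pos (.refl _)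
    have ht : H (Γ.tgt e) = Γ.len e := if_neg fun h => hc (hΓ.of_deleteEdge_eqvGen h)
    have hedge : ∀ e', H ((Γ.deleteEdge e).tgt e') = H ((Γ.deleteEdge e).src e') := fun e' => by
      have h1 : Relation.EqvGen r ((Γ.deleteEdge e).src e') ((Γ.deleteEdge e).tgt e') :=
        .rel _ _ ⟨e', rfl, rfl⟩
      have h2 : Relation.EqvGen r (Γ.src e) ((Γ.deleteEdge e).tgt e') ↔
          Relation.EqvGen r (Γ.src e) ((Γ.deleteEdge e).src e') :=
        ⟨fun h => h.trans _ _ _ h1.symm, fun h => h.trans _ _ _ h1⟩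
      simp only [H, h2]
    have hd := hG.drop_eq hΓ (H := H) (a := Γ.src e) (b := Γ.tgt e) fun v => by
      rw [Γ.lap_deleteEdge e H v, lap_apply, Finset.sum_eq_zero fun e' _ => by simp [hedge e'],
        hs, ht, sub_zero, div_self hL.ne']
      ring
    rw [density, greenRes, ← hd, hs, ht]
    simp

end EdgeResistance


/-! ### Integration against signed measures -/

section SignedMeasure

instance isFiniteMeasure_variation {X : Type*} [MeasurableSpace X] (μ : SignedMeasure X) :
    IsFiniteMeasure μ.variation := by
  rw [← SignedMeasure.totalVariation_eq_variation]
  exact inferInstance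

lemma signedMeasure_integral_const {X : Type*} [MeasurableSpace X] (μ : SignedMeasure X) (c : ℝ) :
    ∫ᵛ _, c ∂<•μ = c * μ univ := by
  rw [VectorMeasure.integral_const]
  simp [mul_comm]

/-- The Jordan decomposition; it reduces Fubini for a signed measure to the case of finite measures.
-/
lemma exists_integral_eq_sub {X : Type*} [MeasurableSpace X] (μ : SignedMeasure X) :
    ∃ ρ σ : Measure X, IsFiniteMeasure ρ ∧ IsFiniteMeasure σ ∧
      ∀ f : X → ℝ, Measurable f → (∃ C, ∀ x, |f x| ≤ C) →
        ∫ᵛ x, f x ∂<•μ = ∫ x, f x ∂ρ - ∫ x, f x ∂σ := by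
  refine ⟨μ.toJordanDecomposition.posPart, μ.toJordanDecomposition.negPart, inferInstance,
    inferInstance, fun f hf ⟨C, hC⟩ => ?_⟩
  have hint : ∀ ν : SignedMeasure X, ν.Integrable f := fun ν =>
    Integrable.of_bound hf.aestronglyMeasurable C (.of_forall hC)
  conv_lhs => rw [← SignedMeasure.toSignedMeasure_toJordanDecomposition μ]
  rw [JordanDecomposition.toSignedMeasure, VectorMeasure.integral_sub_vectorMeasure (hint _) (hint _),
    VectorMeasure.integral_toSignedMeasure, VectorMeasure.integral_toSignedMeasure]

end SignedMeasure

/-! ### The explicit measure and its integrals -/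

section Canonical

variable {V E : Type*} {Γ : MetricGraph V E} [Fintype V] [Fintype E]

variable (Γ) in
/-- Integration against the measure `∑ (1 - υ(q)/2) δ_q + ∑ c e dx`. -/
noncomputable def canonicalIntegral (c : E → ℝ) (f : Γ.Space → ℝ) : ℝ :=
  ∑ q, (1 - (Γ.valence q : ℝ) / 2) * f (Γ.vertex q) +
    ∑ e, c e * ∫ t in (0 : ℝ)..(Γ.len e), f (Γ.edgePoint e t)

variable (Γ) in
/-- The measure `∑ (1 - υ(q)/2) δ_q + ∑ c e dx`. -/
noncomputable def explicitMeasure (c : E → ℝ) : SignedMeasure Γ.Space :=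
  ∑ q, (1 - (Γ.valence q : ℝ) / 2) • VectorMeasure.dirac (Γ.vertex q) (1 : ℝ) +
    ∑ e, c e • ((volume.restrict (Ioc 0 (Γ.len e))).map (Γ.edgePoint e)).toSignedMeasure

omit [Fintype V] [Fintype E] in
lemma exists_bound [Finite V] [Finite E] {f : Γ.Space → ℝ} (hf : Continuous f) :
    ∃ C, ∀ x, |f x| ≤ C := by
  obtain ⟨C, hC⟩ := isCompact_univ.exists_bound_of_continuousOn (f := f) hf.continuousOn
  exact ⟨C, fun x => hC x (mem_univ x)⟩

lemma integral_explicitMeasure (c : E → ℝ) {f : Γ.Space → ℝ} (hf : Continuous f) :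
    ∫ᵛ x, f x ∂<•(Γ.explicitMeasure c) = Γ.canonicalIntegral c f := by
  obtain ⟨C, hC⟩ := exists_bound hf
  have hint : ∀ ν : SignedMeasure Γ.Space, ν.Integrable f := fun ν =>
    Integrable.of_bound hf.measurable.aestronglyMeasurable C (.of_forall hC)
  rw [explicitMeasure, VectorMeasure.integral_add_vectorMeasure (hint _) (hint _),
    VectorMeasure.integral_finsetSum_vectorMeasure fun _ _ => hint _,
    VectorMeasure.integral_finsetSum_vectorMeasure fun _ _ => hint _, canonicalIntegral]
  congr 1
  · refine Finset.sum_congr rfl fun q _ => ?_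
    rw [VectorMeasure.integral_smul_vectorMeasure,
      VectorMeasure.integral_dirac' hf.measurable.stronglyMeasurable]
    simp
  · refine Finset.sum_congr rfl fun e _ => ?_
    rw [VectorMeasure.integral_smul_vectorMeasure, VectorMeasure.integral_toSignedMeasure,
      integral_map (Γ.continuous_edgePoint e).aemeasurable hf.measurable.aestronglyMeasurable,
      intervalIntegral.integral_of_le (Γ.len_pos e).le, smul_eq_mul]

lemma sum_valence_mul (f : V → ℝ) :
    ∑ q, (Γ.valence q : ℝ) * f q = ∑ e, (f (Γ.src e) + f (Γ.tgt e)) := by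
  classical
  have h : ∀ g : E → V, ∑ q, (Nat.card {e // g e = q} : ℝ) * f q = ∑ e, f (g e) := fun g => by
    rw [← Finset.sum_fiberwise (s := Finset.univ) (g := g)]
    refine Finset.sum_congr rfl fun q _ => ?_
    rw [Finset.sum_congr rfl (g := fun _ => f q) fun e he => by rw [(Finset.mem_filter.1 he).2]]
    simp [Fintype.card_subtype]
  simp only [valence, Nat.cast_add, add_mul, Finset.sum_add_distrib, h]

lemma canonicalIntegral_combination (c : E → ℝ) {f g : Γ.Space → ℝ} (hf : Continuous f)
    (hg : Continuous g) (a b : ℝ) : Γ.canonicalIntegral c (fun x => a * f x + b * g x) =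
      a * Γ.canonicalIntegral c f + b * Γ.canonicalIntegral c g := by
  have h : ∀ e, ∫ t in (0 : ℝ)..(Γ.len e), (a * f (Γ.edgePoint e t) + b * g (Γ.edgePoint e t)) =
      a * (∫ t in (0 : ℝ)..(Γ.len e), f (Γ.edgePoint e t)) +
        b * ∫ t in (0 : ℝ)..(Γ.len e), g (Γ.edgePoint e t) := fun e => by
    have := Γ.continuous_edgePoint e
    rw [intervalIntegral.integral_add, intervalIntegral.integral_const_mul,
      intervalIntegral.integral_const_mul] <;>
    exact Continuous.intervalIntegrable (by fun_prop) _ _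
  simp only [canonicalIntegral, h, mul_add, Finset.sum_add_distrib, Finset.mul_sum]
  simp only [mul_left_comm]
  ring

variable {o : V} {G : V → V → ℝ}

omit [Fintype V] [Fintype E] in
lemma density_mul_len (e : E) : Γ.density G e * Γ.len e = 1 - Γ.greenRes G e / Γ.len e := by
  have := (Γ.len_pos e).ne'
  rw [density]; field_simp

namespace IsGreen

variable (hG : Γ.IsGreen o G)

include hG

/-- The vertices contribute `|V| - |E|` and the edges `|E| - ∑ ρ / L`; by Foster's theorem the total
is 1. -/
lemma canonicalIntegral_const (a : ℝ) :
    Γ.canonicalIntegral (Γ.density G) (fun _ => a) = a := by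
  have h1 := Γ.sum_valence_mul fun _ => a
  have h2 : ∀ e, Γ.density G e * (Γ.len e * a) = a - Γ.greenRes G e / Γ.len e * a := fun e => by
    rw [← mul_assoc, density_mul_len]; ring
  have h3 : ∑ q, (1 - (Γ.valence q : ℝ) / 2) * a =
      ∑ _ : V, a - (∑ q, (Γ.valence q : ℝ) * a) / 2 := by
    rw [Finset.sum_div, ← Finset.sum_sub_distrib]
    exact Finset.sum_congr rfl fun q _ => by ring
  simp only [canonicalIntegral, intervalIntegral.integral_const, sub_zero, smul_eq_mul]
  rw [h3, h1, Finset.sum_congr rfl fun e _ => h2 e, Finset.sum_sub_distrib, ← Finset.sum_mul,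
    hG.foster]
  simp only [Finset.sum_const, Finset.card_univ, nsmul_eq_mul]
  ring

end IsGreen

omit [Fintype V] [Fintype E] in
lemma integral_tent {e : E} {s : ℝ} (hs : s ∈ Ioo 0 (Γ.len e)) :
    ∫ t in (0 : ℝ)..(Γ.len e), Γ.tent e t (Γ.edgePoint e s) = s * (Γ.len e - s) / 2 := by
  have hL := (Γ.len_pos e).ne'
  have h1 : ∫ t in (0 : ℝ)..(Γ.len e), Γ.tent e t (Γ.edgePoint e s) =
      ∫ t in (0 : ℝ)..(Γ.len e), (min s t - s * t / Γ.len e) := by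
    refine intervalIntegral.integral_congr fun t ht => ?_
    rw [uIcc_of_le (Γ.len_pos e).le] at ht
    exact tent_edgePoint ht (Ioo_subset_Icc_self hs)
  have hii : ∀ a b, IntervalIntegrable (fun t => min s t) volume a b := fun a b =>
    Continuous.intervalIntegrable (by fun_prop) _ _
  have h2 : ∫ t in (0 : ℝ)..s, min s t = s ^ 2 / 2 := by
    rw [intervalIntegral.integral_congr (g := fun t => t) fun t ht => ?_, integral_id]
    · ring
    · rw [uIcc_of_le hs.1.le] at ht
      exact min_eq_right ht.2
  have h3 : ∫ t in s..(Γ.len e), min s t = s * (Γ.len e - s) := by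
    rw [intervalIntegral.integral_congr (g := fun _ => s) fun t ht => ?_,
      intervalIntegral.integral_const, smul_eq_mul, mul_comm]
    rw [uIcc_of_le hs.2.le] at ht
    exact min_eq_left ht.1
  rw [h1, intervalIntegral.integral_sub (hii _ _)
    (Continuous.intervalIntegrable (by fun_prop) _ _),
    ← intervalIntegral.integral_add_adjacent_intervals (hii 0 s) (hii s _), h2, h3,
    intervalIntegral.integral_div, intervalIntegral.integral_const_mul, integral_id]
  field_simp
  ring

omit [Fintype V] in
-- Integrating the Dirichlet Green's function solves `-f'' = c` with zero boundary values, giving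
-- half the parabola.
lemma sum_integral_tent (c : E → ℝ) (x : Γ.Space) :
    ∑ e, c e * ∫ t in (0 : ℝ)..(Γ.len e), Γ.tent e t x = Γ.parabola c x / 2 := by
  induction x using Space.cases with
  | hv v => simp
  | he e s hs =>
    rw [Finset.sum_eq_single e, integral_tent hs, parabola_edgePoint _ (Ioo_subset_Icc_self hs)]
    · ring
    · intro e' _ he'
      simp [tent_edgePoint_of_ne (Ne.symm he')]
    · simp

omit [Fintype V] [Fintype E] in
lemma continuous_tent_param (e : E) (x : Γ.Space) : Continuous fun t => Γ.tent e t x := by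
  induction x using Space.cases with
  | hv v => exact continuous_const
  | he e' s hs =>
    by_cases h : e' = e
    · subst h
      have : (fun t => Γ.tent e' t (Γ.edgePoint e' s)) = fun t =>
          min s (projIcc 0 (Γ.len e') (Γ.len_pos e').le t) -
            s * projIcc 0 (Γ.len e') (Γ.len_pos e').le t / Γ.len e' := by
        ext t
        rw [tent, lift_edgePoint (Ioo_subset_Icc_self hs), pointMass_self, one_mul]
      rw [this]
      have := continuous_projIcc (h := (Γ.len_pos e').le)
      fun_prop
    · simp only [tent_edgePoint_of_ne h]
      exact continuous_const

omit [Fintype V] [Fintype E] in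
lemma abs_tent_le {e : E} {t : ℝ} (ht : t ∈ Icc 0 (Γ.len e)) (x : Γ.Space) :
    |Γ.tent e t x| ≤ Γ.len e := by
  have hL := Γ.len_pos e
  induction x using Space.cases with
  | hv v => simpa using hL.le
  | he e' s hs =>
    by_cases h : e' = e
    · subst h
      rw [tent_edgePoint ht (Ioo_subset_Icc_self hs)]
      have h1 : s * t / Γ.len e' ≤ Γ.len e' := by
        rw [div_le_iff₀ hL]
        exact mul_le_mul hs.2.le ht.2 ht.1 hL.le
      have h2 : 0 ≤ s * t / Γ.len e' := div_nonneg (mul_nonneg hs.1.le ht.1) hL.le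
      have h3 : 0 ≤ min s t := le_min hs.1.le ht.1
      have h4 : min s t ≤ Γ.len e' := (min_le_right _ _).trans ht.2
      rw [abs_le]
      constructor <;> linarith
    · rw [tent_edgePoint_of_ne h, abs_zero]
      exact hL.le

end Canonical

/-! ### Constancy of the integrated resistance, and Fubini -/

section Tau

variable {V E : Type*} {Γ : MetricGraph V E} [Fintype V] [Fintype E] {o : V} {G : V → V → ℝ}

namespace IsGreen

variable (hG : Γ.IsGreen o G)

include hG

omit [Fintype V] in
lemma continuous_green_left (y : Γ.Space) : Continuous fun x => Γ.green G x y :=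
  (hG.hasLaplacian y).continuous

omit [Fintype V] in
lemma continuous_green_right (x : Γ.Space) : Continuous fun y => Γ.green G x y := by
  simp only [hG.green_comm x]
  exact hG.continuous_green_left x

omit [Fintype V] in
lemma continuous_green_self : Continuous fun x => Γ.green G x x := by
  simp only [hG.green_self]
  exact (continuous_interp _).add (continuous_parabola _)

/-- A bound uniform in both variables, needed for integrability in Fubini: along an edge the value
is a convex combination of interpolated values plus a tent of height at most `len e`. -/
lemma exists_bound_green : ∃ C, ∀ x y, |Γ.green G x y| ≤ C := by
  choose M hM using fun v => exists_bound (continuous_interp (Γ := Γ) (G v))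
  have hM0 : ∀ v, 0 ≤ M v := fun v => (abs_nonneg _).trans (hM v (Γ.vertex v))
  have hle : ∀ v x, |Γ.interp (G v) x| ≤ ∑ v, M v := fun v x =>
    (hM v x).trans (Finset.single_le_sum (fun v _ => hM0 v) (Finset.mem_univ v))
  have hL0 : 0 ≤ ∑ e, Γ.len e := Finset.sum_nonneg fun e _ => (Γ.len_pos e).le
  refine ⟨∑ v, M v + ∑ e, Γ.len e, fun x y => ?_⟩
  induction y using Space.cases with
  | hv v =>
    rw [hG.green_vertex_right]
    linarith [hle v x]
  | he e t ht =>
    have hL := Γ.len_pos e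
    have ht' := Ioo_subset_Icc_self ht
    have h1 := abs_le.1 (hle (Γ.src e) x)
    have h2 := abs_le.1 (hle (Γ.tgt e) x)
    have h3 := abs_le.1 ((abs_tent_le ht' x).trans
      (Finset.single_le_sum (fun e _ => (Γ.len_pos e).le) (Finset.mem_univ e)))
    have h4 : 0 ≤ t / Γ.len e := div_nonneg ht.1.le hL.le
    have h5 : t / Γ.len e ≤ 1 := (div_le_one hL).2 ht.2.le
    rw [hG.green_edgePoint x ht', abs_le]
    have h6 : (Γ.interp (G (Γ.tgt e)) x - Γ.interp (G (Γ.src e)) x) / Γ.len e * t =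
      t / Γ.len e * (Γ.interp (G (Γ.tgt e)) x - Γ.interp (G (Γ.src e)) x) := by ring
    rw [h6]
    constructor <;> nlinarith

lemma canonicalIntegral_green (x : Γ.Space) :
    Γ.canonicalIntegral (Γ.density G) (fun y => Γ.green G x y) =
      ∑ q, Γ.interp (G q) x - (∑ e, Γ.greenRes G e / Γ.len e *
        (Γ.interp (G (Γ.src e)) x + Γ.interp (G (Γ.tgt e)) x)) / 2 +
        Γ.parabola (Γ.density G) x / 2 := by
  have h1 : ∑ q, (1 - (Γ.valence q : ℝ) / 2) * Γ.interp (G q) x = ∑ q, Γ.interp (G q) x -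
      (∑ e, (Γ.interp (G (Γ.src e)) x + Γ.interp (G (Γ.tgt e)) x)) / 2 := by
    rw [← Γ.sum_valence_mul (fun q => Γ.interp (G q) x), Finset.sum_div,
      ← Finset.sum_sub_distrib]
    exact Finset.sum_congr rfl fun q _ => by ring
  have h2 : ∀ e, ∫ t in (0 : ℝ)..(Γ.len e), Γ.green G x (Γ.edgePoint e t) = Γ.len e / 2 *
      (Γ.interp (G (Γ.src e)) x + Γ.interp (G (Γ.tgt e)) x) +
        ∫ t in (0 : ℝ)..(Γ.len e), Γ.tent e t x := fun e => by
    have hL := (Γ.len_pos e).ne'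
    rw [intervalIntegral.integral_congr fun t ht => hG.green_edgePoint x
        (by rwa [uIcc_of_le (Γ.len_pos e).le] at ht),
      intervalIntegral.integral_add (Continuous.intervalIntegrable (by fun_prop) _ _)
        ((continuous_tent_param e x).intervalIntegrable _ _),
      intervalIntegral.integral_add (Continuous.intervalIntegrable (by fun_prop) _ _)
        (Continuous.intervalIntegrable (by fun_prop) _ _),
      intervalIntegral.integral_const, intervalIntegral.integral_const_mul, integral_id,
      smul_eq_mul]
    field_simp
    ring
  simp only [canonicalIntegral, hG.green_vertex_right, h2, mul_add (Γ.density G _)]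
  rw [Finset.sum_add_distrib, sum_integral_tent, h1, ← add_assoc]
  congr 1
  rw [sub_add, sub_right_inj, Finset.sum_div, Finset.sum_div, ← Finset.sum_sub_distrib]
  refine Finset.sum_congr rfl fun e _ => ?_
  -- Each end of `e` gets `-1/2` from the valence and `density * len / 2` from the affine part, in
  -- total `-ρ / (2 L)`.
  rw [show Γ.greenRes G e / Γ.len e = 1 - Γ.density G e * Γ.len e by rw [density_mul_len]; ring]
  ring

lemma canonicalIntegral_resistance (hΓ : Γ.Connected) :
    ∃ c, ∀ x, Γ.canonicalIntegral (Γ.density G) (fun y => Γ.resistance x y) = c := by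
  obtain ⟨c, hc⟩ := hG.canonical_const hΓ
  refine ⟨c + Γ.canonicalIntegral (Γ.density G) (fun y => Γ.green G y y), fun x => ?_⟩
  have h1 : ∀ y, Γ.resistance x y = 1 * (Γ.green G x x * 1 + 1 * Γ.green G y y) +
      (-2) * Γ.green G x y := fun y => by rw [hG.resistance_eq hΓ]; ring
  simp only [h1]
  rw [canonicalIntegral_combination (f := fun y => Γ.green G x x * 1 + 1 * Γ.green G y y) _
      (continuous_const.add (hG.continuous_green_self.const_mul 1)) (hG.continuous_green_right x),
    canonicalIntegral_combination _ continuous_const hG.continuous_green_self,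
    hG.canonicalIntegral_const, hG.canonicalIntegral_green, hG.green_self]
  -- The parabola of `green_self` cancels twice the half parabola of `canonicalIntegral_green`. What
  -- remains is the interpolation of the vertex function that `canonical_const` shows to be
  -- constant.
  have h2 : Γ.interp (fun v => G v v) x - 2 * ∑ q, Γ.interp (G q) x +
      ∑ e, Γ.greenRes G e / Γ.len e *
        (Γ.interp (G (Γ.src e)) x + Γ.interp (G (Γ.tgt e)) x) = c := by
    have h3 : Γ.interp ((fun v => G v v) - (2 : ℝ) • ∑ q, G q +
        ∑ e, (Γ.greenRes G e / Γ.len e) • (G (Γ.src e) + G (Γ.tgt e))) x = c := by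
      have h4 : (fun v => G v v) - (2 : ℝ) • ∑ q, G q +
          ∑ e, (Γ.greenRes G e / Γ.len e) • (G (Γ.src e) + G (Γ.tgt e)) = fun _ => c := by
        ext v
        rw [← hc v]
        simp [mul_add]
      rw [h4]
      induction x using Space.cases with
      | hv v => simp
      | he e t ht => simp [interp_edgePoint _ (Ioo_subset_Icc_self ht)]
    rw [← h3]
    simp only [map_add, map_sub, map_smul, map_sum, Pi.add_apply, Pi.sub_apply, Pi.smul_apply,
      Finset.sum_apply, smul_eq_mul]
  linarith

lemma continuous_resistance (hΓ : Γ.Connected) (x : Γ.Space) :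
    (Continuous fun y => Γ.resistance x y) ∧ Continuous fun y => Γ.resistance y x := by
  simp only [hG.resistance_eq hΓ]
  have h1 := hG.continuous_green_left x
  have h2 := hG.continuous_green_right x
  have h3 := hG.continuous_green_self
  constructor <;> fun_prop

lemma exists_bound_resistance (hΓ : Γ.Connected) : ∃ C, ∀ x y, |Γ.resistance x y| ≤ C := by
  obtain ⟨C, hC⟩ := hG.exists_bound_green
  refine ⟨4 * C, fun x y => ?_⟩
  have h1 := abs_le.1 (hC x x)
  have h2 := abs_le.1 (hC y y)
  have h3 := abs_le.1 (hC x y)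
  rw [hG.resistance_eq hΓ, abs_le]
  constructor <;> linarith

lemma resistance_comm (hΓ : Γ.Connected) (x y : Γ.Space) :
    Γ.resistance x y = Γ.resistance y x := by
  rw [hG.resistance_eq hΓ, hG.resistance_eq hΓ, hG.green_comm x y]; ring

end IsGreen

/-- Fubini's theorem for the explicit measure. -/
lemma canonicalIntegral_integral_swap (c : E → ℝ) (μ : SignedMeasure Γ.Space)
    {F : Γ.Space → Γ.Space → ℝ} (hF : ∀ x, Continuous fun y => F x y)
    (hF' : ∀ y, Continuous fun x => F x y) (hb : ∃ C, ∀ x y, |F x y| ≤ C) :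
    Γ.canonicalIntegral c (fun y => ∫ᵛ x, F x y ∂<•μ) =
      ∫ᵛ x, Γ.canonicalIntegral c (F x) ∂<•μ := by
  obtain ⟨C, hC⟩ := hb
  obtain ⟨ρ, σ, _, _, hμ⟩ := exists_integral_eq_sub μ
  -- Separate continuity suffices: along an edge one variable is a real parameter, and a function
  -- continuous in it and measurable in the other is jointly measurable.
  have hm : ∀ e, Measurable (Function.uncurry fun (x : Γ.Space) (t : ℝ) =>
      F x (Γ.edgePoint e t)) := fun e =>
    (measurable_uncurry_of_continuous_of_measurable (u := fun t x => F x (Γ.edgePoint e t))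
      (fun x => (hF x).comp (Γ.continuous_edgePoint e))
      (fun t => (hF' _).measurable)).comp measurable_swap
  have hprod : ∀ e (κ : Measure Γ.Space) [IsFiniteMeasure κ], Integrable
      (Function.uncurry fun (x : Γ.Space) (t : ℝ) => F x (Γ.edgePoint e t))
      (κ.prod (volume.restrict (Ioc 0 (Γ.len e)))) := fun e κ _ =>
    Integrable.of_bound (hm e).aestronglyMeasurable C (.of_forall fun p => hC _ _)
  have hvert : ∀ (κ : Measure Γ.Space) [IsFiniteMeasure κ] y, Integrable (fun x => F x y) κ :=
    fun κ _ y => Integrable.of_bound (hF' y).measurable.aestronglyMeasurable C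
      (.of_forall fun x => hC _ _)
  have hswap : ∀ e (κ : Measure Γ.Space) [IsFiniteMeasure κ],
      ∫ t in (0 : ℝ)..(Γ.len e), ∫ x, F x (Γ.edgePoint e t) ∂κ =
        ∫ x, (∫ t in (0 : ℝ)..(Γ.len e), F x (Γ.edgePoint e t)) ∂κ := fun e κ _ => by
    simp only [intervalIntegral.integral_of_le (Γ.len_pos e).le]
    exact (integral_integral_swap (hprod e κ)).symm
  have hint : ∀ e (κ : Measure Γ.Space) [IsFiniteMeasure κ],
      Integrable (fun x => ∫ t in (0 : ℝ)..(Γ.len e), F x (Γ.edgePoint e t)) κ :=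
    fun e κ _ => by
      simp only [intervalIntegral.integral_of_le (Γ.len_pos e).le]
      exact (hprod e κ).integral_prod_left
  have hint' : ∀ e (κ : Measure Γ.Space) [IsFiniteMeasure κ],
      IntervalIntegrable (fun t => ∫ x, F x (Γ.edgePoint e t) ∂κ) volume 0 (Γ.len e) :=
    fun e κ _ => by
      rw [intervalIntegrable_iff_integrableOn_Ioc_of_le (Γ.len_pos e).le]
      exact (hprod e κ).integral_prod_right
  have hpos : ∀ (κ : Measure Γ.Space) [IsFiniteMeasure κ],
      Γ.canonicalIntegral c (fun y => ∫ x, F x y ∂κ) = ∫ x, Γ.canonicalIntegral c (F x) ∂κ :=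
    fun κ _ => by
      simp only [canonicalIntegral]
      rw [integral_add (integrable_finsetSum _ fun q _ => (hvert κ _).const_mul _)
          (integrable_finsetSum _ fun e _ => (hint e κ).const_mul _),
        integral_finsetSum _ fun q _ => (hvert κ _).const_mul _,
        integral_finsetSum _ fun e _ => (hint e κ).const_mul _]
      simp only [integral_const_mul, hswap]
  have hFμ : ∀ y, ∫ᵛ x, F x y ∂<•μ = ∫ x, F x y ∂ρ - ∫ x, F x y ∂σ := fun y =>
    hμ _ (hF' y).measurable ⟨C, fun x => hC x y⟩
  have hsub : Γ.canonicalIntegral c (fun y => ∫ x, F x y ∂ρ - ∫ x, F x y ∂σ) =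
      Γ.canonicalIntegral c (fun y => ∫ x, F x y ∂ρ) -
        Γ.canonicalIntegral c (fun y => ∫ x, F x y ∂σ) := by
    simp only [canonicalIntegral, intervalIntegral.integral_sub (hint' _ ρ) (hint' _ σ), mul_sub,
      Finset.sum_sub_distrib]
    ring
  simp only [hFμ]
  rw [hsub, hpos ρ, hpos σ, hμ]
  · refine Measurable.add (Finset.measurable_sum _ fun q _ => (hF' _).measurable.const_mul _)
      (Finset.measurable_sum _ fun e _ => Measurable.const_mul ?_ _)
    simp only [intervalIntegral.integral_of_le (Γ.len_pos e).le]
    exact (hm e).stronglyMeasurable.integral_prod_right.measurable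
  · refine ⟨∑ q, |1 - (Γ.valence q : ℝ) / 2| * C + ∑ e, |c e| * (C * Γ.len e), fun x => ?_⟩
    refine (abs_add_le _ _).trans (add_le_add ?_ ?_) <;>
      refine (Finset.abs_sum_le_sum_abs _ _).trans (Finset.sum_le_sum fun i _ => ?_) <;>
      rw [abs_mul] <;> refine mul_le_mul_of_nonneg_left ?_ (abs_nonneg _)
    · exact hC _ _
    · have h := intervalIntegral.norm_integral_le_of_norm_le_const (a := 0) (b := Γ.len i)
        (f := fun t => F x (Γ.edgePoint i t)) fun t _ => hC x (Γ.edgePoint i t)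
      rwa [sub_zero, abs_of_pos (Γ.len_pos i)] at h

end Tau
end MetricGraph

theorem mainTheorem8 {V E : Type*} [Fintype V] [Fintype E] [Nonempty V]
    (Γ : MetricGraph V E) (hΓ : Γ.Connected) :
    (∃ μ : SignedMeasure Γ.Space, Γ.IsCanonicalMeasure μ) ∧
    (∀ μ : SignedMeasure Γ.Space, Γ.IsCanonicalMeasure μ →
      ∀ x, (1 / 2) * Γ.voltageMeasure μ x x = Γ.tau) ∧
    ∀ p : V,
      Γ.tau =
        -(1 / 4) * ∑ q : V, ((Γ.valence q : ℝ) - 2) * Γ.resistance (Γ.vertex p) (Γ.vertex q) +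
        (1 / 2) * ∑ e : E, ((ENNReal.ofReal (Γ.len e) + Γ.edgeResistance e)⁻¹).toReal *
          ∫ x in (0 : ℝ)..(Γ.len e), Γ.resistance (Γ.vertex p) (Γ.edgePoint e x) := by
  obtain ⟨G, hG⟩ := hΓ.exists_isGreen (Classical.arbitrary V)
  obtain ⟨c, hc⟩ := hG.canonicalIntegral_resistance hΓ
  have hvm : ∀ (μ : SignedMeasure Γ.Space) x,
      Γ.voltageMeasure μ x x = ∫ᵛ ζ, Γ.resistance ζ x ∂<•μ := fun _ _ => rfl
  have hex : Γ.IsCanonicalMeasure (Γ.explicitMeasure (Γ.density G)) := by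
    refine ⟨?_, c, fun x => ?_⟩
    · have h1 := MetricGraph.signedMeasure_integral_const (Γ.explicitMeasure (Γ.density G)) 1
      rw [MetricGraph.integral_explicitMeasure _ continuous_const, hG.canonicalIntegral_const, one_mul] at h1
      exact h1.symm
    · rw [hvm, MetricGraph.integral_explicitMeasure _ (hG.continuous_resistance hΓ x).2, ← hc x]
      simp only [hG.resistance_comm hΓ x]
  have huniq : ∀ μ : SignedMeasure Γ.Space, Γ.IsCanonicalMeasure μ →
      ∀ x, Γ.voltageMeasure μ x x = c := by
    rintro μ ⟨h1, d, hd⟩ x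
    have hd' : (fun _ => d) = fun x => ∫ᵛ ζ, Γ.resistance ζ x ∂<•μ :=
      funext fun x => (hd x).symm
    -- As the explicit measure has mass 1, `d` is the double integral of the resistance; swapping
    -- the order integrates the constant `c` against `μ`, of mass 1.
    rw [hd, ← hG.canonicalIntegral_const d, hd', MetricGraph.canonicalIntegral_integral_swap _ μ (fun x => (hG.continuous_resistance hΓ x).1)
      (fun x => (hG.continuous_resistance hΓ x).2) (hG.exists_bound_resistance hΓ)]
    simp only [hc]
    rw [MetricGraph.signedMeasure_integral_const, h1, mul_one]
  have htau : Γ.tau = 1 / 2 * c := by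
    rw [MetricGraph.tau, huniq Γ.canonicalMeasure (Classical.epsilon_spec ⟨_, hex⟩)]
  refine ⟨⟨_, hex⟩, fun μ hμ x => by rw [huniq μ hμ, htau], fun p => ?_⟩
  simp only [htau, ← hc (Γ.vertex p), MetricGraph.canonicalIntegral, hG.inv_len_add_edgeResistance hΓ,
    mul_add]
  congr 1
  rw [Finset.mul_sum, Finset.mul_sum]
  exact Finset.sum_congr rfl fun q _ => by ring
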